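/- **Setting.** Let $m\ge 3$ be an integer. For $r>0$ put $h_1(r)=\frac{2}{r^m+r^{-m}}$, $h_3(r)=\frac{r^m-r^{-m}}{r^m+r^{-m}}$, $\mathbf h=(h_1,0,h_3)$, $\hat{\boldsymbol\jmath}=(0,1,0)$, $\hat{\mathbf k}=(0,0,1)$, and let $R$ be the matrix $R(x_1,x_2,x_3)=(-x_2,x_1,0)$, so that $e^{\alpha R}$ is the rotation by $\alpha$ about the third axis. All $L^p$ norms below are those of $L^p((0,\infty),r\,dr)$. All functions of $r$ (or $\rho$) below that are differentiated are locally absolutely continuous on $(0,\infty)$. Let $\mathbf u(r,\theta)=e^{m\theta R}\mathbf v(r)$ be an $m$-equivariant map $\mathbb R^2\to\mathbb S^2$ of finite energy $\pi\int_0^\infty\big(|\mathbf v_r|^2+\frac{m^2}{r^2}(v_1^2+v_2^2)\big)r\,dr<\infty$ with $\mathbf v(0+)=-\hat{\mathbf k}$ and $\mathbf v(\infty)=\hat{\mathbf k}$. Suppose that for some $s>0$, $\alpha\in\mathbb R$ and $z=z_1+iz_2:(0,\infty)\to\mathbb C$ we have, with $\rho=r/s$, $$\mathbf v(r)=e^{\alpha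 R}\big[(1+\gamma(\rho))\mathbf h(\rho)+z_1(\rho)\hat{\boldsymbol\jmath}+z_2(\rho)\,\mathbf h(\rho)\times\hat{\boldsymbol\jmath}\big],\qquad \gamma=(1-|z|^2)^{1/2}-1,$$ where $$\|z\|_X:=\Big(\int_0^\infty\Big(|z_\rho|^2+\frac{|z|^2}{\rho^2}\Big)\rho\,d\rho\Big)^{1/2}<\infty\qquad\text{and}\qquad \int_0^\infty z(\rho)h_1(\rho)\,\rho\,d\rho=0 .$$ Let $\mathbf W=\mathbf v_r-\frac mr\,\mathbf v\times R\mathbf v$, let $\mathbf e(r)$ be a unit tangent field along $\mathbf v$ (so $|\mathbf e|=1$, $\mathbf e\cdot\mathbf v=0$) with $\mathbf e_r-(\mathbf e_r\cdot\mathbf v)\mathbf v=0$ a.e., and let $q=q_1+iq_2$ be the complex function with $\mathbf W=q_1\mathbf e+q_2\,\mathbf v\times\mathbf e$ a.e. **Proposition.** For every integer $m\ge3$ there is $\varepsilon=\varepsilon(m)>0$ such that the following holds. 1. For every $2\le p<\infty$ there is a constant $C=C(m,p)$ such that, for all $\mathbf v,s,\alpha,z,q$ as above with $\|z\|_X\le\varepsilon$,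 $$\|z_\rho\|_{L^p}+\Big\|\frac z\rho\Big\|_{L^p}\le C\,s^{1-2/p}\,\|q\|_{L^p}.$$ 2. If $m>3$, there is a constant $C=C(m)$ such that, for all $\mathbf v,s,\alpha,z,q$ as above with $\|z\|_X\le\varepsilon$, $$\Big\|\frac{z_\rho}\rho\Big\|_{L^2}+\Big\|\frac z{\rho^2}\Big\|_{L^2}\le C\,s\,\Big\|\frac qr\Big\|_{L^2}.$$ (The right-hand sides may be $+\infty$; when they are finite, so are the left-hand sides.) -/

import Mathlib

open MeasureTheory Set Filter Topology
open scoped Matrix ENNReal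

namespace SchrodingerMap

noncomputable section

/-- Local absolute continuity on the half line `(0, ∞)`. Such a function is differentiable almost
everywhere and is the integral of `deriv f`; up to a null set, these are exactly the functions on
`(0, ∞)` with a locally integrable weak derivative, and `deriv f` is that weak derivative. -/
def LocallyAC {E : Type*} [PseudoMetricSpace E] (f : ℝ → E) : Prop :=
  ∀ a b : ℝ, 0 < a → a ≤ b → AbsolutelyContinuousOnInterval f a b

/-- The measure `r dr` on `(0, ∞)`: planar Lebesgue measure on radial functions, without the
factor `2π`. -/
def radialMeasure : Measure ℝ :=
  (volume.restrict (Ioi (0 : ℝ))).withDensity (fun r => ENNReal.ofReal r)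

/-- `‖f‖_{L^p(r dr)}`, with values in `[0, ∞]`. -/
def radialNorm (p : ℝ) (f : ℝ → ℂ) : ℝ≥0∞ :=
  eLpNorm f (ENNReal.ofReal p) radialMeasure

/-- `h₁(r) = 2 / (r^m + r^{-m})`. -/
def h₁ (m : ℕ) (r : ℝ) : ℝ := 2 / (r ^ m + (r ^ m)⁻¹)

/-- `h₃(r) = (r^m - r^{-m}) / (r^m + r^{-m})`. -/
def h₃ (m : ℕ) (r : ℝ) : ℝ := (r ^ m - (r ^ m)⁻¹) / (r ^ m + (r ^ m)⁻¹)

/-- The profile `h = (h₁, 0, h₃)` of the harmonic map. -/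
def hvec (m : ℕ) (r : ℝ) : Fin 3 → ℝ := ![h₁ m r, 0, h₃ m r]

/-- The unit vector `(0, 1, 0)`. -/
def jhat : Fin 3 → ℝ := ![0, 1, 0]

/-- The unit vector `(0, 0, 1)`. -/
def khat : Fin 3 → ℝ := ![0, 0, 1]

/-- The generator `R` of rotations about the vertical axis. -/
def rotGen : Matrix (Fin 3) (Fin 3) ℝ := !![0, -1, 0; 1, 0, 0; 0, 0, 0]

/-- The rotation `e^{αR}` about the vertical axis by the angle `α`. -/
def rot (α : ℝ) : Matrix (Fin 3) (Fin 3) ℝ :=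
  !![Real.cos α, -Real.sin α, 0; Real.sin α, Real.cos α, 0; 0, 0, 1]

/-- `v : (0, ∞) → 𝕊²` is the radial profile of a map `u(r, θ) = e^{mθR} v(r)` in the class `Σ_m`:
it has finite energy `π ∫ (|v_r|² + (m²/r²)(v₁² + v₂²)) r dr`, and `v(0) = -k`, `v(∞) = k`. -/
structure IsSigmaProfile (m : ℕ) (v : ℝ → Fin 3 → ℝ) : Prop where
  locallyAC : LocallyAC v
  unit : ∀ r : ℝ, 0 < r → v r ⬝ᵥ v r = 1
  finite_energy :
    ∫⁻ r, ENNReal.ofReal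
      (deriv v r ⬝ᵥ deriv v r + (m : ℝ) ^ 2 / r ^ 2 * ((v r 0) ^ 2 + (v r 1) ^ 2))
      ∂radialMeasure < ∞
  tendsto_zero : Tendsto v (𝓝[>] 0) (𝓝 (-khat))
  tendsto_infty : Tendsto v atTop (𝓝 khat)

/-- `‖z‖_X = (∫₀^∞ (|z_ρ|² + |z|²/ρ²) ρ dρ)^{1/2}`, with values in `[0, ∞]`. -/
def xNorm (z : ℝ → ℂ) : ℝ≥0∞ :=
  (∫⁻ ρ, ENNReal.ofReal (‖deriv z ρ‖ ^ 2 + ‖z ρ‖ ^ 2 / ρ ^ 2) ∂radialMeasure) ^ (1 / 2 : ℝ)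

/-- The energy space `X`. -/
structure MemX (z : ℝ → ℂ) : Prop where
  locallyAC : LocallyAC z
  xNorm_lt_top : xNorm z < ∞

/-- The map `V^ρ : ℂ → T_{h(ρ)} 𝕊²`, `z₁ + i z₂ ↦ z₁ j + z₂ (h(ρ) × j)`. -/
def Vrho (m : ℕ) (ρ : ℝ) (w : ℂ) : Fin 3 → ℝ :=
  w.re • jhat + w.im • (hvec m ρ ⨯₃ jhat)

/-- The normal component `γ = (1 - |z|²)^{1/2} - 1` of the perturbation. -/
def normalPart (w : ℂ) : ℝ := Real.sqrt (1 - ‖w‖ ^ 2) - 1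

/-- The splitting `v(r) = e^{αR} [(1 + γ(ρ)) h(ρ) + V^ρ(z(ρ))]`, `ρ = r/s`, of a profile `v` into
a harmonic map with scale `s` and angle `α` and a perturbation described by `z`. -/
def IsSplitting (m : ℕ) (v : ℝ → Fin 3 → ℝ) (s α : ℝ) (z : ℝ → ℂ) : Prop :=
  ∀ r : ℝ, 0 < r →
    v r = rot α *ᵥ
      ((1 + normalPart (z (r / s))) • hvec m (r / s) + Vrho m (r / s) (z (r / s)))

/-- The tangent field `W = v_r - (m/r) J^v R v`, where `J^v = v ×`. -/
def W (m : ℕ) (v : ℝ → Fin 3 → ℝ) (r : ℝ) : Fin 3 → ℝ :=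
  deriv v r - ((m : ℝ) / r) • (v r ⨯₃ (rotGen *ᵥ v r))

/-- `e` is a unit tangent field along `v` with `D_r^v e = P^v e_r = 0`, where
`P^v w = w - (w · v) v` is the orthogonal projection to the tangent plane at `v`. -/
structure IsParallelFrame (v e : ℝ → Fin 3 → ℝ) : Prop where
  locallyAC : LocallyAC e
  unit : ∀ r : ℝ, 0 < r → e r ⬝ᵥ e r = 1
  tangent : ∀ r : ℝ, 0 < r → e r ⬝ᵥ v r = 0
  parallel : ∀ᵐ r ∂radialMeasure, deriv e r - (deriv e r ⬝ᵥ v r) • v r = 0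

/-- `q = q₁ + i q₂` is the coordinate of `W` in a parallel orthonormal frame `{e, J^v e}`:
`W = q₁ e + q₂ J^v e`. -/
def IsHasimoto (m : ℕ) (v : ℝ → Fin 3 → ℝ) (q : ℝ → ℂ) : Prop :=
  ∃ e : ℝ → Fin 3 → ℝ, IsParallelFrame v e ∧
    ∀ᵐ r ∂radialMeasure, W m v r = (q r).re • e r + (q r).im • (v r ⨯₃ e r)

/-- The condition `(z, h₁)_{L²} = ∫₀^∞ z h₁ ρ dρ = 0`. -/
def IsOrthogonal (m : ℕ) (z : ℝ → ℂ) : Prop :=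
  ∫ ρ in Ioi (0 : ℝ), z ρ * (h₁ m ρ : ℂ) * (ρ : ℂ) = 0

/-- A map in `Σ_m` (through its profile `v`), split with scale `s > 0`, angle `α` and
perturbation `z ∈ X` subject to the orthogonality condition, together with its function `q`. -/
structure IsSplitMap (m : ℕ) (v : ℝ → Fin 3 → ℝ) (s α : ℝ) (z q : ℝ → ℂ) : Prop where
  profile : IsSigmaProfile m v
  scale_pos : 0 < s
  memX : MemX z
  splitting : IsSplitting m v s α z
  orthogonal : IsOrthogonal m z
  hasimoto : IsHasimoto m v q

end

end SchrodingerMap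

open SchrodingerMap

/-! Both estimates are instances of one bound in `L^p(dr/r)` with weight `r^{-κ}`: the first is `κ =
1 - 2/p`, the second is `κ = 1`, `p = 2`. Since `dr/r` is dilation invariant, the scale `s` only
produces the factor `s^κ`.

The field `W` vanishes on the harmonic map. For a perturbation, undo the rotation and the dilation
and project `W` to the tangent plane at `h`: the result is `fullOp`, that is `z' + (m/r)(h₃ z +
N(z))`. A projection does not increase length, so `|fullOp z (t)| ≤ s |q (s t)|`
(`IsSplitMap.ae_norm_fullOp_le`).

The linear part `linOp` annihilates `h₁`, so variation of constants from `r = 1` gives `z(r) = h₁(r)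
z(1) + ∫₁^r (h₁(r)/h₁(s)) linOp z(s) ds`. The power decay of `h₁` at both ends bounds this kernel,
even after conjugation with the weight, by `2 min(r/s, s/r)`, and Schur's test controls `z` up to
the number `z(1)` (`LocallyAC.lnorm_le`). Testing the same formula against `h₁`, the orthogonality
condition bounds `z(1)` by an integral of `linOp z` against `tailWeight`
(`LocallyAC.enorm_apply_one_le`). Hölder's inequality applies to that integral when `κ < m - 2`:
automatic for `κ = 1 - 2/p` and `m ≥ 3`, but for `κ = 1` it is `m > 3`.

The nonlinearity satisfies `|N(z)| ≤ (|z|² + 2 h₁ |z|) |z|`, with a coefficient that is small both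
in the supremum norm and in `L¹(dr/r)`. The first smallness absorbs it in the bound for `z`, the
second in the bound for `z(1)` (`exists_lnorm_le_fullOp`). The derivative is then read off from the
equation. -/

namespace SchrodingerMap

/-! ### The measures `dr/r` and `r dr`, and dilations. -/

/-- The scale invariant measure `dr / r` on `(0, ∞)`. -/
noncomputable def logMeasure : Measure ℝ :=
  (volume.restrict (Ioi (0 : ℝ))).withDensity (fun r => ENNReal.ofReal r⁻¹)

instance : SigmaFinite logMeasure := by unfold logMeasure; infer_instance

/-- The `L^p` norm of a function with values in `[0, ∞]`. -/
noncomputable def lnorm (p : ℝ) (μ : Measure ℝ) (f : ℝ → ℝ≥0∞) : ℝ≥0∞ :=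
  (∫⁻ r, f r ^ p ∂μ) ^ (1 / p)

theorem lintegral_logMeasure (f : ℝ → ℝ≥0∞) :
    ∫⁻ r, f r ∂logMeasure = ∫⁻ r in Ioi (0 : ℝ), ENNReal.ofReal r⁻¹ * f r := by
  rw [logMeasure, lintegral_withDensity_eq_lintegral_mul_non_measurable _ (by fun_prop)
    (Eventually.of_forall fun _ => ENNReal.ofReal_lt_top)]
  rfl

theorem lintegral_radialMeasure (f : ℝ → ℝ≥0∞) :
    ∫⁻ r, f r ∂radialMeasure = ∫⁻ r in Ioi (0 : ℝ), ENNReal.ofReal r * f r := by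
  rw [radialMeasure, lintegral_withDensity_eq_lintegral_mul_non_measurable _ (by fun_prop)
    (Eventually.of_forall fun _ => ENNReal.ofReal_lt_top)]
  rfl

theorem ae_logMeasure_iff {P : ℝ → Prop} :
    (∀ᵐ r ∂logMeasure, P r) ↔ ∀ᵐ r ∂volume, 0 < r → P r := by
  rw [logMeasure, ae_withDensity_iff (by fun_prop), ae_restrict_iff' measurableSet_Ioi]
  refine eventually_congr (Eventually.of_forall fun r => ?_)
  simp only [mem_Ioi, ne_eq, ENNReal.ofReal_eq_zero, inv_nonpos, not_le]
  tauto

theorem ae_radialMeasure_iff {P : ℝ → Prop} :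
    (∀ᵐ r ∂radialMeasure, P r) ↔ ∀ᵐ r ∂volume, 0 < r → P r := by
  rw [radialMeasure, ae_withDensity_iff (by fun_prop), ae_restrict_iff' measurableSet_Ioi]
  refine eventually_congr (Eventually.of_forall fun r => ?_)
  simp only [mem_Ioi, ne_eq, ENNReal.ofReal_eq_zero, not_le]
  tauto

theorem ae_logMeasure_pos : ∀ᵐ r ∂logMeasure, 0 < r :=
  ae_logMeasure_iff.2 (Eventually.of_forall fun _ h => h)

theorem logMeasure_absolutelyContinuous : logMeasure ≪ volume.restrict (Ioi (0 : ℝ)) :=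
  withDensity_absolutelyContinuous _ _

theorem lintegral_radialMeasure_eq_logMeasure (f : ℝ → ℝ≥0∞) :
    ∫⁻ r, f r ∂radialMeasure = ∫⁻ r, ENNReal.ofReal (r ^ 2) * f r ∂logMeasure := by
  rw [lintegral_radialMeasure, lintegral_logMeasure]
  refine setLIntegral_congr_fun measurableSet_Ioi fun r (hr : 0 < r) => ?_
  rw [← mul_assoc, ← ENNReal.ofReal_mul (by positivity)]
  congr 2
  field_simp

theorem ae_volume_comp_mul {P : ℝ → Prop} {s : ℝ} (hs : 0 < s) (h : ∀ᵐ r ∂volume, P r) :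
    ∀ᵐ r ∂volume, P (s * r) := by
  have hq : Measure.QuasiMeasurePreserving (fun r : ℝ => s * r) volume volume := by
    refine ⟨by fun_prop, ?_⟩
    rw [Real.map_volume_mul_left hs.ne']
    exact Measure.smul_absolutelyContinuous
  exact hq.ae h

/-- No measurability of `f` is asked for, because this is applied to `q`, which is an arbitrary
function; the dilation being a measurable embedding makes up for it. -/
theorem lintegral_logMeasure_comp_mul (f : ℝ → ℝ≥0∞) {s : ℝ} (hs : 0 < s) :
    ∫⁻ r, f (s * r) ∂logMeasure = ∫⁻ r, f r ∂logMeasure := by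
  rw [lintegral_logMeasure, lintegral_logMeasure, ← lintegral_indicator measurableSet_Ioi,
    ← lintegral_indicator measurableSet_Ioi]
  set F : ℝ → ℝ≥0∞ := (Ioi (0 : ℝ)).indicator fun r => ENNReal.ofReal r⁻¹ * f r with hF
  have e : MeasurableEmbedding (fun r : ℝ => s * r) :=
    (Homeomorph.mulLeft₀ s hs.ne').measurableEmbedding
  have h1 := e.lintegral_map (μ := volume) F
  rw [Real.map_volume_mul_left hs.ne', lintegral_smul_measure, abs_of_pos (inv_pos.2 hs)] at h1
  have h2 : ∀ r, (Ioi (0 : ℝ)).indicator (fun r => ENNReal.ofReal r⁻¹ * f (s * r)) r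
      = ENNReal.ofReal s * F (s * r) := by
    intro r
    by_cases hr : 0 < r
    · have hsr : 0 < s * r := by positivity
      rw [hF, indicator_of_mem (mem_Ioi.2 hr), indicator_of_mem (mem_Ioi.2 hsr), ← mul_assoc,
        ← ENNReal.ofReal_mul hs.le]
      congr 2
      field_simp
    · have hsr : ¬ 0 < s * r := by simpa [hs] using hr
      rw [hF, indicator_of_notMem (by simpa using hr), indicator_of_notMem (by simpa using hsr),
        mul_zero]
  simp_rw [h2]
  rw [lintegral_const_mul' _ _ ENNReal.ofReal_ne_top, ← h1, smul_eq_mul, ← mul_assoc,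
    ← ENNReal.ofReal_mul hs.le, mul_inv_cancel₀ hs.ne', ENNReal.ofReal_one, one_mul]

/-! ### `L^p` norms of `[0, ∞]`-valued functions, Schur's test, Hölder's inequality. -/

theorem lnorm_mono {p : ℝ} (hp : 0 ≤ p) {μ : Measure ℝ} {f g : ℝ → ℝ≥0∞}
    (h : ∀ᵐ r ∂μ, f r ≤ g r) : lnorm p μ f ≤ lnorm p μ g := by
  refine ENNReal.rpow_le_rpow (lintegral_mono_ae ?_) (by positivity)
  filter_upwards [h] with r hr using ENNReal.rpow_le_rpow hr hp

theorem lnorm_add_le {p : ℝ} (hp : 1 ≤ p) {μ : Measure ℝ} {f g : ℝ → ℝ≥0∞}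
    (hf : AEMeasurable f μ) (hg : AEMeasurable g μ) :
    lnorm p μ (fun r => f r + g r) ≤ lnorm p μ f + lnorm p μ g :=
  ENNReal.lintegral_Lp_add_le hf hg hp

theorem lnorm_const_mul {p : ℝ} (hp : 0 < p) {μ : Measure ℝ} {c : ℝ≥0∞} (hc : c ≠ ∞)
    (f : ℝ → ℝ≥0∞) : lnorm p μ (fun r => c * f r) = c * lnorm p μ f := by
  unfold lnorm
  simp_rw [ENNReal.mul_rpow_of_nonneg _ _ hp.le]
  rw [lintegral_const_mul' _ _ (ENNReal.rpow_ne_top_of_nonneg hp.le hc),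
    ENNReal.mul_rpow_of_nonneg _ _ (by positivity), ← ENNReal.rpow_mul,
    mul_one_div_cancel hp.ne', ENNReal.rpow_one]

theorem lnorm_restrict_le {p : ℝ} (hp : 0 ≤ p) {μ : Measure ℝ} (S : Set ℝ) (f : ℝ → ℝ≥0∞) :
    lnorm p (μ.restrict S) f ≤ lnorm p μ f :=
  ENNReal.rpow_le_rpow (lintegral_mono' Measure.restrict_le_self le_rfl) (by positivity)

/-- **Schur's test** for an integral operator on `L^p`. -/
theorem lnorm_lintegral_kernel_le {p : ℝ} (hp : 1 < p) {μ : Measure ℝ} [SFinite μ]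
    {k : ℝ → ℝ → ℝ≥0∞} (hk : Measurable (Function.uncurry k)) {M : ℝ≥0∞}
    (h₁ : ∀ᵐ r ∂μ, ∫⁻ s, k r s ∂μ ≤ M) (h₂ : ∀ᵐ s ∂μ, ∫⁻ r, k r s ∂μ ≤ M)
    {f : ℝ → ℝ≥0∞} (hf : AEMeasurable f μ) :
    lnorm p μ (fun r => ∫⁻ s, k r s * f s ∂μ) ≤ M * lnorm p μ f := by
  have hp0 : 0 < p := by linarith
  obtain ⟨q, hpq⟩ : ∃ q, p.HolderConjugate q := ⟨_, Real.HolderConjugate.conjExponent hp⟩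
  have hq0 : 0 < q := hpq.symm.pos
  have hsum : 1 / p + 1 / q = 1 := by
    have := hpq.inv_add_inv_eq_one
    simpa [one_div] using this
  have key : ∀ᵐ r ∂μ, (∫⁻ s, k r s * f s ∂μ) ^ p
      ≤ M ^ (p / q) * ∫⁻ s, k r s * f s ^ p ∂μ := by
    filter_upwards [h₁] with r hr
    have hkr : Measurable (k r) := hk.comp measurable_prodMk_left
    -- Split `k = k^{1/p} k^{1/q}` and give `f` to the first factor: the second integrates to the
    -- row bound `M`, and Tonelli with the column bound handles the first.
    have H := ENNReal.lintegral_mul_le_Lp_mul_Lq μ hpq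
      (f := fun s => k r s ^ (1 / p) * f s) (g := fun s => k r s ^ (1 / q))
      ((hkr.pow_const _).aemeasurable.mul hf) (hkr.pow_const _).aemeasurable
    have e1 : ∀ s, ((fun s => k r s ^ (1 / p) * f s) * fun s => k r s ^ (1 / q)) s
        = k r s * f s := by
      intro s
      simp only [Pi.mul_apply]
      rw [mul_right_comm, ← ENNReal.rpow_add_of_nonneg _ _ (by positivity) (by positivity), hsum,
        ENNReal.rpow_one]
    have e2 : ∀ s, (k r s ^ (1 / p) * f s) ^ p = k r s * f s ^ p := by
      intro s
      rw [ENNReal.mul_rpow_of_nonneg _ _ hp0.le, ← ENNReal.rpow_mul, one_div_mul_cancel hp0.ne',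
        ENNReal.rpow_one]
    have e3 : ∀ s, (k r s ^ (1 / q)) ^ q = k r s := by
      intro s
      rw [← ENNReal.rpow_mul, one_div_mul_cancel hq0.ne', ENNReal.rpow_one]
    simp_rw [e1, e2, e3] at H
    calc (∫⁻ s, k r s * f s ∂μ) ^ p
        ≤ ((∫⁻ s, k r s * f s ^ p ∂μ) ^ (1 / p) * (∫⁻ s, k r s ∂μ) ^ (1 / q)) ^ p :=
          ENNReal.rpow_le_rpow H hp0.le
      _ = (∫⁻ s, k r s * f s ^ p ∂μ) * (∫⁻ s, k r s ∂μ) ^ (p / q) := by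
          rw [ENNReal.mul_rpow_of_nonneg _ _ hp0.le, ← ENNReal.rpow_mul, ← ENNReal.rpow_mul,
            one_div_mul_cancel hp0.ne', ENNReal.rpow_one, one_div_mul_eq_div]
      _ ≤ M ^ (p / q) * ∫⁻ s, k r s * f s ^ p ∂μ := by
          rw [mul_comm]
          gcongr
  have hswap : ∫⁻ r, ∫⁻ s, k r s * f s ^ p ∂μ ∂μ ≤ M * ∫⁻ s, f s ^ p ∂μ := by
    rw [lintegral_lintegral_swap (hk.aemeasurable.mul (hf.pow_const p).comp_snd),
      ← lintegral_const_mul'' _ (hf.pow_const p)]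
    refine lintegral_mono_ae ?_
    filter_upwards [h₂] with s hs
    have hks : Measurable fun r => k r s := hk.comp measurable_prodMk_right
    rw [lintegral_mul_const _ hks]
    gcongr
  calc lnorm p μ (fun r => ∫⁻ s, k r s * f s ∂μ)
      ≤ (∫⁻ r, M ^ (p / q) * ∫⁻ s, k r s * f s ^ p ∂μ ∂μ) ^ (1 / p) :=
        ENNReal.rpow_le_rpow (lintegral_mono_ae key) (by positivity)
    _ = (M ^ (p / q) * ∫⁻ r, ∫⁻ s, k r s * f s ^ p ∂μ ∂μ) ^ (1 / p) := by
        rw [lintegral_const_mul'']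
        exact (hk.aemeasurable.mul (hf.pow_const p).comp_snd).lintegral_prod_right'
    _ ≤ (M ^ (p / q) * (M * ∫⁻ s, f s ^ p ∂μ)) ^ (1 / p) := by gcongr
    _ = M * lnorm p μ f := by
        have : M ^ (p / q) * M = M ^ p := by
          conv_lhs => rw [← ENNReal.rpow_one M, ← ENNReal.rpow_mul]
          rw [← ENNReal.rpow_add_of_nonneg _ _ (by positivity) (by positivity)]
          congr 1
          have : p * (1 / p + 1 / q) = p := by rw [hsum, mul_one]
          field_simp at this ⊢
          linarith
        rw [← mul_assoc, this, ENNReal.mul_rpow_of_nonneg _ _ (by positivity), ← ENNReal.rpow_mul,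
          mul_one_div_cancel hp0.ne', ENNReal.rpow_one, lnorm]

/-- Hölder's inequality for a weight bounded by `1`. -/
theorem lintegral_mul_le_lnorm {p q : ℝ} (hpq : p.HolderConjugate q) {μ : Measure ℝ}
    {f b : ℝ → ℝ≥0∞} (hf : AEMeasurable f μ) (hb : AEMeasurable b μ) (hb1 : ∀ᵐ r ∂μ, b r ≤ 1) :
    ∫⁻ r, b r * f r ∂μ ≤ (∫⁻ r, b r ∂μ) ^ (1 / q) * lnorm p μ f := by
  have H := ENNReal.lintegral_mul_le_Lp_mul_Lq μ hpq hf hb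
  -- Since `b ≤ 1` and `q > 1`, only the `L¹` size of the weight enters, whatever `q` is.
  have hle : ∫⁻ r, b r ^ q ∂μ ≤ ∫⁻ r, b r ∂μ := by
    refine lintegral_mono_ae ?_
    filter_upwards [hb1] with r hr
    simpa using ENNReal.rpow_le_rpow_of_exponent_ge hr hpq.symm.lt.le
  calc ∫⁻ r, b r * f r ∂μ = ∫⁻ r, (f * b) r ∂μ := by
        refine lintegral_congr fun r => ?_
        simp [mul_comm]
    _ ≤ _ := H
    _ ≤ _ := by
        rw [mul_comm]
        have := hpq.symm.pos
        exact mul_le_mul_left (ENNReal.rpow_le_rpow hle (by positivity)) _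

/-! ### The dilation invariant kernel. -/

/-- The kernel `min (r / s) (s / r)`. -/
noncomputable def scaleKernel (r s : ℝ) : ℝ := min (r / s) (s / r)

theorem scaleKernel_comm (r s : ℝ) : scaleKernel r s = scaleKernel s r := min_comm _ _

theorem measurable_scaleKernel :
    Measurable (Function.uncurry fun r s => ENNReal.ofReal (scaleKernel r s)) := by
  unfold scaleKernel Function.uncurry
  fun_prop

theorem lintegral_Ioi_rpow {a c : ℝ} (ha : a < -1) (hc : 0 < c) :
    ∫⁻ s in Ioi c, ENNReal.ofReal (s ^ a) = ENNReal.ofReal (-c ^ (a + 1) / (a + 1)) := by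
  rw [← integral_Ioi_rpow_of_lt ha hc, ofReal_integral_eq_lintegral_ofReal
    (integrableOn_Ioi_rpow_of_lt ha hc)]
  refine (ae_restrict_iff' measurableSet_Ioi).2 (Eventually.of_forall fun s hs => ?_)
  exact Real.rpow_nonneg (hc.le.trans (mem_Ioi.1 hs).le) _

/-- Each of the two ranges `s ≤ r` and `s > r` contributes at most `1`. By symmetry of the kernel
this serves as both the row and the column bound in Schur's test. -/
theorem lintegral_scaleKernel_le {r : ℝ} (hr : 0 < r) :
    ∫⁻ s, ENNReal.ofReal (scaleKernel r s) ∂logMeasure ≤ 2 := by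
  rw [lintegral_logMeasure, ← Ioc_union_Ioi_eq_Ioi hr.le]
  refine (lintegral_union_le _ _ _).trans ?_
  have h1 : ∫⁻ s in Ioc 0 r, ENNReal.ofReal s⁻¹ * ENNReal.ofReal (scaleKernel r s) ≤ 1 := by
    calc _ ≤ ∫⁻ s in Ioc 0 r, ENNReal.ofReal r⁻¹ := by
          refine setLIntegral_mono' measurableSet_Ioc fun s hs => ?_
          rw [← ENNReal.ofReal_mul (inv_nonneg.2 hs.1.le)]
          refine ENNReal.ofReal_le_ofReal ?_
          calc s⁻¹ * scaleKernel r s ≤ s⁻¹ * (s / r) :=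
                mul_le_mul_of_nonneg_left (min_le_right _ _) (inv_nonneg.2 hs.1.le)
            _ = r⁻¹ := by have := hs.1.ne'; field_simp
      _ = 1 := by
          rw [setLIntegral_const, Real.volume_Ioc, sub_zero, ← ENNReal.ofReal_mul (by positivity),
            inv_mul_cancel₀ hr.ne', ENNReal.ofReal_one]
  have h2 : ∫⁻ s in Ioi r, ENNReal.ofReal s⁻¹ * ENNReal.ofReal (scaleKernel r s) ≤ 1 := by
    calc _ ≤ ∫⁻ s in Ioi r, ENNReal.ofReal r * ENNReal.ofReal (s ^ (-2 : ℝ)) := by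
          refine setLIntegral_mono' measurableSet_Ioi fun s hs => ?_
          have hs0 : 0 < s := hr.trans hs
          rw [← ENNReal.ofReal_mul (inv_nonneg.2 hs0.le), ← ENNReal.ofReal_mul hr.le]
          refine ENNReal.ofReal_le_ofReal ?_
          calc s⁻¹ * scaleKernel r s ≤ s⁻¹ * (r / s) :=
                mul_le_mul_of_nonneg_left (min_le_left _ _) (inv_nonneg.2 hs0.le)
            _ = r * s ^ (-2 : ℝ) := by
                rw [Real.rpow_neg hs0.le, Real.rpow_two]; field_simp
      _ = 1 := by
          rw [lintegral_const_mul' _ _ ENNReal.ofReal_ne_top, lintegral_Ioi_rpow (by norm_num) hr,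
            ← ENNReal.ofReal_mul hr.le]
          norm_num
          rw [Real.rpow_neg_one, mul_inv_cancel₀ hr.ne']
  calc _ ≤ (1 : ℝ≥0∞) + 1 := add_le_add h1 h2
    _ = 2 := one_add_one_eq_two

/-! ### The harmonic map profile. -/

theorem h₁_pos (m : ℕ) {r : ℝ} (hr : 0 < r) : 0 < h₁ m r := by
  unfold h₁; positivity

theorem h₁_one (m : ℕ) : h₁ m 1 = 1 := by simp [h₁]; norm_num

theorem h₁_sq_add_h₃_sq (m : ℕ) {r : ℝ} (hr : 0 < r) : h₁ m r ^ 2 + h₃ m r ^ 2 = 1 := by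
  unfold h₁ h₃
  have : 0 < r ^ m := by positivity
  field_simp
  ring

theorem abs_h₃_le_one (m : ℕ) {r : ℝ} (hr : 0 < r) : |h₃ m r| ≤ 1 :=
  abs_le_of_sq_le_sq' (by nlinarith [h₁_sq_add_h₃_sq m hr, sq_nonneg (h₁ m r)]) zero_le_one
    |> abs_le.2

theorem h₁_le_one (m : ℕ) {r : ℝ} (hr : 0 < r) : h₁ m r ≤ 1 := by
  nlinarith [h₁_sq_add_h₃_sq m hr, sq_nonneg (h₃ m r), h₁_pos m hr]

theorem hasDerivAt_pow_pos (m : ℕ) {r : ℝ} (hr : 0 < r) :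
    HasDerivAt (fun r : ℝ => r ^ m) (m / r * r ^ m) r := by
  refine (hasDerivAt_pow m r).congr_deriv ?_
  rcases m with _ | n
  · simp
  · field_simp
    simp [pow_succ]

theorem hasDerivAt_pow_inv (m : ℕ) {r : ℝ} (hr : 0 < r) :
    HasDerivAt (fun r : ℝ => (r ^ m)⁻¹) (-(m / r * (r ^ m)⁻¹)) r := by
  have : 0 < r ^ m := by positivity
  refine ((hasDerivAt_pow_pos m hr).fun_inv this.ne').congr_deriv ?_
  field_simp

theorem hasDerivAt_h₁ (m : ℕ) {r : ℝ} (hr : 0 < r) :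
    HasDerivAt (h₁ m) (-(m / r * h₁ m r * h₃ m r)) r := by
  have h0 : 0 < r ^ m := by positivity
  have h2 : r ^ m + (r ^ m)⁻¹ ≠ 0 := by positivity
  refine ((hasDerivAt_const r (2 : ℝ)).fun_div
    ((hasDerivAt_pow_pos m hr).fun_add (hasDerivAt_pow_inv m hr)) h2).congr_deriv ?_
  unfold h₁ h₃
  field_simp
  ring

theorem hasDerivAt_h₃ (m : ℕ) {r : ℝ} (hr : 0 < r) :
    HasDerivAt (h₃ m) (m / r * h₁ m r ^ 2) r := by
  have h0 : 0 < r ^ m := by positivity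
  have h2 : r ^ m + (r ^ m)⁻¹ ≠ 0 := by positivity
  refine (((hasDerivAt_pow_pos m hr).fun_sub (hasDerivAt_pow_inv m hr)).fun_div
    ((hasDerivAt_pow_pos m hr).fun_add (hasDerivAt_pow_inv m hr)) h2).congr_deriv ?_
  unfold h₁
  field_simp
  ring

/-- For `s ≥ 1` one has `1 / h₁(s) ≤ s^m`, while `h₁(r) ≤ 2 r^{-m}` for every `r > 0`. The next
lemma is the mirror image under `r ↦ 1/r`. -/
theorem h₁_div_le_of_one_le (m : ℕ) {r s : ℝ} (hs : 1 ≤ s) (hr : 0 < r) :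
    h₁ m r / h₁ m s ≤ 2 * (s / r) ^ m := by
  have h0 : 0 < r ^ m := by positivity
  have h1 : 1 ≤ s ^ m := one_le_pow₀ hs
  have h2 : (s ^ m)⁻¹ ≤ s ^ m := (inv_le_one_of_one_le₀ h1).trans h1
  unfold h₁
  rw [div_div_div_cancel_left' _ _ two_ne_zero, div_pow, div_le_iff₀ (by positivity)]
  calc s ^ m + (s ^ m)⁻¹ ≤ 2 * (s ^ m / r ^ m) * r ^ m := by
        have : 2 * (s ^ m / r ^ m) * r ^ m = 2 * s ^ m := by field_simp
        linarith
    _ ≤ 2 * (s ^ m / r ^ m) * (r ^ m + (r ^ m)⁻¹) := by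
      gcongr
      simpa using h0.le

theorem h₁_div_le_of_le_one (m : ℕ) {r s : ℝ} (hs0 : 0 < s) (hs : s ≤ 1) (hr : 0 < r) :
    h₁ m r / h₁ m s ≤ 2 * (r / s) ^ m := by
  have h0 : 0 < r ^ m := by positivity
  have h1 : s ^ m ≤ 1 := pow_le_one₀ hs0.le hs
  have h3 : 0 < s ^ m := by positivity
  have h2 : s ^ m ≤ (s ^ m)⁻¹ := h1.trans (one_le_inv_iff₀.2 ⟨h3, h1⟩)
  unfold h₁
  rw [div_div_div_cancel_left' _ _ two_ne_zero, div_pow, div_le_iff₀ (by positivity)]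
  calc s ^ m + (s ^ m)⁻¹ ≤ 2 * (r ^ m / s ^ m) * (r ^ m)⁻¹ := by
        have : 2 * (r ^ m / s ^ m) * (r ^ m)⁻¹ = 2 * (s ^ m)⁻¹ := by field_simp
        linarith
    _ ≤ 2 * (r ^ m / s ^ m) * (r ^ m + (r ^ m)⁻¹) := by
      gcongr
      simpa using h0.le

theorem h₁_inv_eq (m : ℕ) (r : ℝ) : (h₁ m r)⁻¹ = (r ^ m + (r ^ m)⁻¹) / 2 := by
  unfold h₁; rw [inv_div]

/-! ### Locally absolutely continuous functions. -/

theorem LocallyAC.lipschitz_comp {E F : Type*} [PseudoMetricSpace E] [PseudoMetricSpace F]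
    {f : ℝ → E} (hf : LocallyAC f) {φ : E → F} (hφ : ∀ x y, dist (φ x) (φ y) ≤ dist x y) :
    LocallyAC fun r => φ (f r) := by
  intro a b ha hab
  have := hf a b ha hab
  rw [absolutelyContinuousOnInterval_iff] at this ⊢
  intro ε hε
  obtain ⟨δ, hδ, H⟩ := this ε hε
  exact ⟨δ, hδ, fun E hE hE' =>
    (Finset.sum_le_sum fun i _ => hφ _ _).trans_lt (H E hE hE')⟩

theorem LocallyAC.re {z : ℝ → ℂ} (hz : LocallyAC z) : LocallyAC fun r => (z r).re :=
  hz.lipschitz_comp fun x y => by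
    rw [Real.dist_eq, dist_eq_norm, ← Complex.sub_re]; exact Complex.abs_re_le_norm _

theorem LocallyAC.im {z : ℝ → ℂ} (hz : LocallyAC z) : LocallyAC fun r => (z r).im :=
  hz.lipschitz_comp fun x y => by
    rw [Real.dist_eq, dist_eq_norm, ← Complex.sub_im]; exact Complex.abs_im_le_norm _

theorem LocallyAC.ae_differentiableAt_real {f : ℝ → ℝ} (hf : LocallyAC f) :
    ∀ᵐ r : ℝ, 0 < r → DifferentiableAt ℝ f r := by
  -- The intervals `[1/(n+1), n+1]` exhaust the half line, and countably many null sets are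
  -- discarded.
  have h : ∀ n : ℕ, ∀ᵐ r : ℝ, r ∈ uIcc (1 / ((n : ℝ) + 1)) (n + 1) → DifferentiableAt ℝ f r := by
    intro n
    refine (hf _ _ (by positivity) ?_).ae_differentiableAt
    rw [div_le_iff₀ (by positivity)]
    nlinarith [(Nat.cast_nonneg n : (0 : ℝ) ≤ n)]
  filter_upwards [ae_all_iff.2 h] with r hr h0
  obtain ⟨n, hn⟩ := exists_nat_gt (max r (1 / r))
  refine hr n (mem_uIcc.2 (Or.inl ⟨?_, ?_⟩))
  · have : 1 / r < n := (le_max_right _ _).trans_lt hn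
    rw [div_le_iff₀ (by positivity)]
    rw [div_lt_iff₀ h0] at this
    nlinarith
  · have : r < n := (le_max_left _ _).trans_lt hn
    linarith

theorem LocallyAC.ae_differentiableAt {z : ℝ → ℂ} (hz : LocallyAC z) :
    ∀ᵐ r : ℝ, 0 < r → DifferentiableAt ℝ z r := by
  filter_upwards [hz.re.ae_differentiableAt_real, hz.im.ae_differentiableAt_real] with r h1 h2 h0
  have h3 := (h1 h0).hasDerivAt.ofReal_comp.add ((h2 h0).hasDerivAt.ofReal_comp.mul_const Complex.I)
  refine (h3.congr_of_eventuallyEq (Eventually.of_forall fun t => ?_)).differentiableAt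
  simp

theorem LocallyAC.continuousOn {E : Type*} [SeminormedAddCommGroup E] {z : ℝ → E}
    (hz : LocallyAC z) : ContinuousOn z (Ioi 0) := by
  intro r (hr : 0 < r)
  have h := (hz (r / 2) (2 * r) (by positivity) (by linarith)).continuousOn
  rw [uIcc_of_le (by linarith)] at h
  exact (h.continuousAt (Icc_mem_nhds (by linarith) (by linarith))).continuousWithinAt

/-- The fundamental theorem of calculus for a complex function. -/
theorem LocallyAC.integral_deriv_eq_sub {z : ℝ → ℂ} (hz : LocallyAC z) {a b : ℝ} (ha : 0 < a)
    (hb : 0 < b) : ∫ r in a..b, deriv z r = z b - z a := by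
  wlog hab : a ≤ b generalizing a b
  · rw [intervalIntegral.integral_symm, this hb ha (le_of_not_ge hab), neg_sub]
  have hre := hz.re a b ha hab
  have him := hz.im a b ha hab
  have hd : ∀ᵐ r, r ∈ uIoc a b → deriv z r
      = ((deriv (fun r => (z r).re) r : ℝ) : ℂ) + ((deriv (fun r => (z r).im) r : ℝ) : ℂ) * .I := by
    filter_upwards [hz.ae_differentiableAt] with r hr hrm
    have hr0 : 0 < r := by
      rw [uIoc_of_le hab] at hrm
      exact ha.trans hrm.1
    have h1 : HasDerivAt (fun r => (z r).re) (deriv z r).re r :=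
      (Complex.reCLM.hasFDerivAt.comp_hasDerivAt r (hr hr0).hasDerivAt)
    have h2 : HasDerivAt (fun r => (z r).im) (deriv z r).im r :=
      (Complex.imCLM.hasFDerivAt.comp_hasDerivAt r (hr hr0).hasDerivAt)
    rw [h1.deriv, h2.deriv, Complex.re_add_im]
  rw [intervalIntegral.integral_congr_ae hd, intervalIntegral.integral_add,
    intervalIntegral.integral_mul_const, intervalIntegral.integral_ofReal,
    intervalIntegral.integral_ofReal, hre.integral_deriv_eq_sub, him.integral_deriv_eq_sub]
  · apply Complex.ext <;> simp
  · exact ⟨hre.intervalIntegrable_deriv.1.ofReal, hre.intervalIntegrable_deriv.2.ofReal⟩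
  · exact IntervalIntegrable.mul_const
      ⟨him.intervalIntegrable_deriv.1.ofReal, him.intervalIntegrable_deriv.2.ofReal⟩ _

theorem LocallyAC.enorm_sub_le {z : ℝ → ℂ} (hz : LocallyAC z) {a b : ℝ} (ha : 0 < a)
    (hb : 0 < b) : ‖z b - z a‖ₑ ≤ ∫⁻ r in uIoc a b, ‖deriv z r‖ₑ := by
  rw [← hz.integral_deriv_eq_sub ha hb, intervalIntegral.intervalIntegral_eq_integral_uIoc]
  split_ifs
  · rw [one_smul]; exact enorm_integral_le_lintegral_enorm _
  · rw [neg_smul, one_smul, enorm_neg]; exact enorm_integral_le_lintegral_enorm _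

theorem setLIntegral_logMeasure {S : Set ℝ} (hS : MeasurableSet S) (hS0 : S ⊆ Ioi 0)
    (f : ℝ → ℝ≥0∞) :
    ∫⁻ r in S, f r ∂logMeasure = ∫⁻ r in S, ENNReal.ofReal r⁻¹ * f r := by
  rw [← lintegral_indicator hS, lintegral_logMeasure, ← lintegral_indicator hS,
    ← lintegral_indicator measurableSet_Ioi]
  refine lintegral_congr fun r => ?_
  by_cases hr : r ∈ S
  · simp [hr, hS0 hr]
  · simp [hr]

theorem uIoc_one_subset {r : ℝ} (hr : 0 < r) : uIoc 1 r ⊆ Ioi 0 := by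
  intro s hs
  have : min 1 r < s := hs.1
  exact (lt_min one_pos hr).trans this

/-! ### The linear operator and variation of constants. -/

/-- The linear operator `z ↦ z' + (m / r) h₃ z`, which annihilates `h₁`. -/
noncomputable def linOp (m : ℕ) (z : ℝ → ℂ) (r : ℝ) : ℂ :=
  deriv z r + ((m / r * h₃ m r : ℝ) : ℂ) * z r

theorem LocallyAC.div_h₁ {z : ℝ → ℂ} (hz : LocallyAC z) (m : ℕ) :
    LocallyAC fun r => ((h₁ m r)⁻¹ : ℝ) • z r := by
  intro a b ha hab
  refine AbsolutelyContinuousOnInterval.fun_smul ?_ (hz a b ha hab)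
  refine ContDiffOn.absolutelyContinuousOnInterval ?_
  simp_rw [h₁_inv_eq]
  have : ∀ r ∈ uIcc a b, r ^ m ≠ 0 := by
    intro r hr
    rw [uIcc_of_le hab] at hr
    exact pow_ne_zero _ (ha.trans_le hr.1).ne'
  exact ((contDiffOn_id.pow m).add ((contDiffOn_id.pow m).inv this)).div_const 2

/-- `1 / h₁` is an integrating factor for `linOp`, because `h₁' = -(m/r) h₁ h₃`. -/
theorem deriv_div_h₁ {z : ℝ → ℂ} {m : ℕ} {r : ℝ} (hr : 0 < r) (hz : DifferentiableAt ℝ z r) :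
    deriv (fun r => ((h₁ m r)⁻¹ : ℝ) • z r) r = ((h₁ m r)⁻¹ : ℝ) • linOp m z r := by
  have h := ((hasDerivAt_h₁ m hr).fun_inv (h₁_pos m hr).ne').fun_smul hz.hasDerivAt
  rw [h.deriv, linOp, smul_add, Complex.real_smul, Complex.real_smul, Complex.real_smul]
  congr 1
  rw [← mul_assoc, ← Complex.ofReal_mul]
  congr 2
  have := (h₁_pos m hr).ne'
  field_simp

/-- Variation of constants for `linOp`, starting at `r = 1`. -/
theorem LocallyAC.enorm_sub_h₁_mul_le {z : ℝ → ℂ} (hz : LocallyAC z) (m : ℕ) {r : ℝ} (hr : 0 < r) :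
    ‖z r - h₁ m r * z 1‖ₑ ≤ ∫⁻ s in uIoc 1 r,
      ENNReal.ofReal (h₁ m r / h₁ m s) * ‖(s : ℂ) * linOp m z s‖ₑ ∂logMeasure := by
  have H := (hz.div_h₁ m).enorm_sub_le one_pos hr
  have hp := h₁_pos m hr
  rw [h₁_one, inv_one, one_smul] at H
  have e1 : z r - h₁ m r * z 1 = (h₁ m r : ℂ) * (((h₁ m r)⁻¹ : ℝ) • z r - z 1) := by
    have : (h₁ m r : ℂ) ≠ 0 := by exact_mod_cast hp.ne'
    rw [Complex.real_smul, Complex.ofReal_inv]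
    field_simp
  rw [e1, enorm_mul, setLIntegral_logMeasure measurableSet_uIoc (uIoc_one_subset hr)]
  calc _ ≤ ‖(h₁ m r : ℂ)‖ₑ * ∫⁻ s in uIoc 1 r, ‖deriv (fun r => ((h₁ m r)⁻¹ : ℝ) • z r) s‖ₑ := by
        gcongr
    _ = ∫⁻ s in uIoc 1 r, ‖(h₁ m r : ℂ)‖ₑ * ‖deriv (fun r => ((h₁ m r)⁻¹ : ℝ) • z r) s‖ₑ :=
        (lintegral_const_mul' _ _ enorm_ne_top).symm
    _ = _ := by
        refine setLIntegral_congr_fun_ae measurableSet_uIoc ?_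
        filter_upwards [hz.ae_differentiableAt] with s hs hsm
        have hs0 : 0 < s := uIoc_one_subset hr hsm
        have hps := h₁_pos m hs0
        rw [deriv_div_h₁ hs0 (hs hs0), ← enorm_mul,
          ← Real.enorm_of_nonneg (inv_nonneg.2 hs0.le),
          ← Real.enorm_of_nonneg (div_nonneg hp.le hps.le), ← enorm_norm (_ * _),
          ← enorm_norm ((s : ℂ) * _), ← enorm_mul, ← enorm_mul]
        congr 1
        simp only [norm_mul, norm_smul, Complex.norm_real, Real.norm_eq_abs, abs_of_pos hp,
          abs_inv, abs_of_pos hps, abs_of_pos hs0]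
        field_simp

theorem LocallyAC.aemeasurable {z : ℝ → ℂ} (hz : LocallyAC z) : AEMeasurable z logMeasure :=
  ((hz.continuousOn.aestronglyMeasurable measurableSet_Ioi).aemeasurable).mono_ac
    logMeasure_absolutelyContinuous

theorem measurable_h₁ (m : ℕ) : Measurable (h₁ m) := by unfold h₁; fun_prop

theorem measurable_h₃ (m : ℕ) : Measurable (h₃ m) := by unfold h₃; fun_prop

theorem LocallyAC.aemeasurable_linOp {z : ℝ → ℂ} (hz : LocallyAC z) (m : ℕ) :
    AEMeasurable (linOp m z) logMeasure := by
  have h := hz.aemeasurable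
  have h3 := measurable_h₃ m
  have hd := measurable_deriv z
  unfold linOp
  fun_prop

/-! ### The energy norm and its embedding into bounded functions. -/

theorem lintegral_xNorm_le {z : ℝ → ℂ} {ε : ℝ} (hε : 0 ≤ ε) (h : xNorm z ≤ ENNReal.ofReal ε) :
    ∫⁻ r, ENNReal.ofReal ((r * ‖deriv z r‖) ^ 2 + ‖z r‖ ^ 2) ∂logMeasure
      ≤ ENNReal.ofReal (ε ^ 2) := by
  have e : ∫⁻ r, ENNReal.ofReal ((r * ‖deriv z r‖) ^ 2 + ‖z r‖ ^ 2) ∂logMeasure =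
      ∫⁻ ρ, ENNReal.ofReal (‖deriv z ρ‖ ^ 2 + ‖z ρ‖ ^ 2 / ρ ^ 2) ∂radialMeasure := by
    rw [lintegral_radialMeasure_eq_logMeasure]
    refine lintegral_congr_ae ?_
    filter_upwards [ae_logMeasure_pos] with r hr
    rw [← ENNReal.ofReal_mul (by positivity)]
    congr 1
    field_simp
  rw [e]
  have h2 := ENNReal.rpow_le_rpow h (zero_le_two (α := ℝ))
  rw [xNorm, ← ENNReal.rpow_mul, one_div_mul_cancel two_ne_zero, ENNReal.rpow_one,
    ENNReal.rpow_two, ← ENNReal.ofReal_pow hε] at h2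
  exact h2

theorem lintegral_sq_le {z : ℝ → ℂ} {ε : ℝ} (hε : 0 ≤ ε) (h : xNorm z ≤ ENNReal.ofReal ε) :
    ∫⁻ r, ENNReal.ofReal (‖z r‖ ^ 2) ∂logMeasure ≤ ENNReal.ofReal (ε ^ 2) := by
  refine le_trans (lintegral_mono fun r => ENNReal.ofReal_le_ofReal ?_) (lintegral_xNorm_le hε h)
  nlinarith [sq_nonneg (r * ‖deriv z r‖)]

/-- The exact value is `log 2`; the bounds `1` and, below, `1/2` are all that is used. -/
theorem logMeasure_Ioc_le {r : ℝ} (hr : 0 < r) : logMeasure (Ioc r (2 * r)) ≤ 1 := by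
  have hs : Ioc r (2 * r) ⊆ Ioi 0 := fun s hs => hr.trans hs.1
  rw [← setLIntegral_one, setLIntegral_logMeasure measurableSet_Ioc hs]
  calc _ ≤ ∫⁻ s in Ioc r (2 * r), ENNReal.ofReal r⁻¹ := by
        refine setLIntegral_mono' measurableSet_Ioc fun s hs => ?_
        rw [mul_one]
        exact ENNReal.ofReal_le_ofReal (inv_anti₀ hr hs.1.le)
    _ = 1 := by
        rw [setLIntegral_const, Real.volume_Ioc, ← ENNReal.ofReal_mul (by positivity)]
        rw [show r⁻¹ * (2 * r - r) = 1 by field_simp; ring, ENNReal.ofReal_one]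

theorem le_logMeasure_Ioc {r : ℝ} (hr : 0 < r) :
    ENNReal.ofReal (1 / 2) ≤ logMeasure (Ioc r (2 * r)) := by
  have hs : Ioc r (2 * r) ⊆ Ioi 0 := fun s hs => hr.trans hs.1
  rw [← setLIntegral_one, setLIntegral_logMeasure measurableSet_Ioc hs]
  calc ENNReal.ofReal (1 / 2) = ∫⁻ s in Ioc r (2 * r), ENNReal.ofReal (2 * r)⁻¹ := by
        rw [setLIntegral_const, Real.volume_Ioc, ← ENNReal.ofReal_mul (by positivity)]
        rw [show (2 * r)⁻¹ * (2 * r - r) = 1 / 2 by field_simp; ring]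
    _ ≤ _ := by
        refine setLIntegral_mono' measurableSet_Ioc fun s hs => ?_
        rw [mul_one]
        exact ENNReal.ofReal_le_ofReal (inv_anti₀ (hr.trans hs.1) hs.2)

/-- The embedding of the energy space `X` into the bounded functions. -/
theorem LocallyAC.norm_le_of_xNorm_le {z : ℝ → ℂ} (hz : LocallyAC z) {ε : ℝ} (hε : 0 < ε)
    (h : xNorm z ≤ ENNReal.ofReal ε) {r : ℝ} (hr : 0 < r) : ‖z r‖ ≤ 3 * ε := by
  have hE := lintegral_xNorm_le hε.le h
  have hsub : Ioc r (2 * r) ⊆ Ioi 0 := fun s hs => hr.trans hs.1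
  by_contra! hlt
  -- On a dyadic interval `z` oscillates by at most `ε`: use `t |z'| ≤ ε/2 + (t |z'|)²/(2ε)`, the
  -- mass bound `1` and the energy bound `ε²`.
  have hosc : ∀ s ∈ Ioc r (2 * r), ‖z s - z r‖ₑ ≤ ENNReal.ofReal ε := by
    intro s hs
    have hs0 : 0 < s := hr.trans hs.1
    calc ‖z s - z r‖ₑ ≤ ∫⁻ t in uIoc r s, ‖deriv z t‖ₑ := hz.enorm_sub_le hr hs0
      _ ≤ ∫⁻ t in Ioc r (2 * r), ‖deriv z t‖ₑ := by
          refine lintegral_mono_set ?_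
          rw [uIoc_of_le hs.1.le]
          exact Ioc_subset_Ioc_right hs.2
      _ ≤ ∫⁻ t in Ioc r (2 * r), (ENNReal.ofReal (ε / 2) + ENNReal.ofReal (1 / (2 * ε)) *
            ENNReal.ofReal ((t * ‖deriv z t‖) ^ 2 + ‖z t‖ ^ 2)) ∂logMeasure := by
          rw [setLIntegral_logMeasure measurableSet_Ioc hsub]
          refine setLIntegral_mono' measurableSet_Ioc fun t ht => ?_
          have ht0 : 0 < t := hr.trans ht.1
          rw [← ENNReal.ofReal_mul (by positivity), ← ENNReal.ofReal_add (by positivity)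
            (by positivity), ← ENNReal.ofReal_mul (by positivity), ← ofReal_norm]
          refine ENNReal.ofReal_le_ofReal ?_
          rw [inv_mul_eq_div, le_div_iff₀ ht0]
          have : ε / 2 + 1 / (2 * ε) * ((t * ‖deriv z t‖) ^ 2 + ‖z t‖ ^ 2) - ‖deriv z t‖ * t
              = ((ε - t * ‖deriv z t‖) ^ 2 + ‖z t‖ ^ 2) / (2 * ε) := by
            field_simp; ring
          have : 0 ≤ ((ε - t * ‖deriv z t‖) ^ 2 + ‖z t‖ ^ 2) / (2 * ε) := by positivity
          linarith
      _ ≤ ENNReal.ofReal (ε / 2) * 1 + ENNReal.ofReal (1 / (2 * ε)) * ENNReal.ofReal (ε ^ 2) := by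
          rw [lintegral_add_left (by fun_prop), setLIntegral_const,
            lintegral_const_mul' _ _ ENNReal.ofReal_ne_top]
          gcongr
          · exact logMeasure_Ioc_le hr
          · exact (setLIntegral_le_lintegral _ _).trans hE
      _ = ENNReal.ofReal ε := by
          rw [mul_one, ← ENNReal.ofReal_mul (by positivity), ← ENNReal.ofReal_add (by positivity)
            (by positivity)]
          congr 1
          field_simp
          ring
  have hlow : ∀ s ∈ Ioc r (2 * r), 2 * ε ≤ ‖z s‖ := by
    intro s hs
    have h1 := hosc s hs
    rw [← ofReal_norm, ENNReal.ofReal_le_ofReal_iff hε.le] at h1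
    have h2 := norm_sub_norm_le (z r) (z s)
    rw [norm_sub_rev] at h2
    linarith
  -- If `|z(r)| > 3ε`, then `|z| ≥ 2ε` on an interval of mass at least `1/2`, so the energy would be
  -- at least `2ε²`, more than allowed.
  have : ENNReal.ofReal ((2 * ε) ^ 2) * ENNReal.ofReal (1 / 2) ≤ ENNReal.ofReal (ε ^ 2) := by
    calc _ ≤ ENNReal.ofReal ((2 * ε) ^ 2) * logMeasure (Ioc r (2 * r)) := by
          gcongr; exact le_logMeasure_Ioc hr
      _ = ∫⁻ s in Ioc r (2 * r), ENNReal.ofReal ((2 * ε) ^ 2) ∂logMeasure := by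
          rw [setLIntegral_const]
      _ ≤ ∫⁻ s in Ioc r (2 * r), ENNReal.ofReal (‖z s‖ ^ 2) ∂logMeasure := by
          refine setLIntegral_mono' measurableSet_Ioc fun s hs => ENNReal.ofReal_le_ofReal ?_
          exact pow_le_pow_left₀ (by positivity) (hlow s hs) 2
      _ ≤ _ := (setLIntegral_le_lintegral _ _).trans (lintegral_sq_le hε.le h)
  rw [← ENNReal.ofReal_mul (by positivity), ENNReal.ofReal_le_ofReal_iff (by positivity)] at this
  nlinarith [sq_pos_of_pos hε]

/-! ### The weighted bound for `z` in terms of `z(1)` and the linear operator. -/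

theorem scaleKernel_of_le {r s : ℝ} (hs : 0 < s) (h : s ≤ r) : scaleKernel r s = s / r := by
  have hr : 0 < r := hs.trans_le h
  refine min_eq_right ?_
  rw [div_le_div_iff₀ hr hs]
  nlinarith

theorem scaleKernel_of_ge {r s : ℝ} (hr : 0 < r) (h : r ≤ s) : scaleKernel r s = r / s := by
  rw [scaleKernel_comm, scaleKernel_of_le hr h]

theorem scaleKernel_le_one {r s : ℝ} (hr : 0 < r) (hs : 0 < s) : scaleKernel r s ≤ 1 := by
  rcases le_total s r with h | h
  · rw [scaleKernel_of_le hs h]; exact div_le_one_of_le₀ h hr.le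
  · rw [scaleKernel_of_ge hr h]; exact div_le_one_of_le₀ h hs.le

theorem scaleKernel_nonneg {r s : ℝ} (hr : 0 < r) (hs : 0 < s) : 0 ≤ scaleKernel r s :=
  le_min (by positivity) (by positivity)

/-- For `1 ≤ s ≤ r` the weight only helps. For `r ≤ s ≤ 1` moving it from `r` to `s` costs at most
one power of `s/r`, since `κ ≤ 1`; the factor `(r/s)^m` with `m ≥ 2` pays for this and leaves one
power. -/
theorem rpow_neg_mul_h₁_div_le {m : ℕ} (hm : 2 ≤ m) {κ : ℝ} (h0 : 0 ≤ κ) (h1 : κ ≤ 1) {r s : ℝ}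
    (hr : 0 < r) (hs : 0 < s) (hrs : (1 ≤ s ∧ s ≤ r) ∨ (r ≤ s ∧ s ≤ 1)) :
    r ^ (-κ) * (h₁ m r / h₁ m s) ≤ 2 * (scaleKernel r s * s ^ (-κ)) := by
  have hpr : 0 < r ^ (-κ) := Real.rpow_pos_of_pos hr _
  have hps : 0 < s ^ (-κ) := Real.rpow_pos_of_pos hs _
  rcases hrs with ⟨hs1, hsr⟩ | ⟨hrs, hs1⟩
  · rw [scaleKernel_of_le hs hsr]
    have ht : s / r ≤ 1 := div_le_one_of_le₀ hsr hr.le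
    have ha : r ^ (-κ) ≤ s ^ (-κ) := Real.rpow_le_rpow_of_nonpos hs hsr (by linarith)
    have hb : (s / r) ^ m ≤ s / r := pow_le_of_le_one (by positivity) ht (by omega)
    calc r ^ (-κ) * (h₁ m r / h₁ m s) ≤ s ^ (-κ) * (2 * (s / r)) := by
          refine mul_le_mul ha ((h₁_div_le_of_one_le m hs1 hr).trans (by linarith)) ?_ hps.le
          exact div_nonneg (h₁_pos m hr).le (h₁_pos m hs).le
      _ = _ := by ring
  · rw [scaleKernel_of_ge hr hrs]
    have ht : r / s ≤ 1 := div_le_one_of_le₀ hrs hs.le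
    have ha : r ^ (-κ) ≤ s ^ (-κ) * (s / r) := by
      have e : r ^ (-κ) = s ^ (-κ) * (s / r) ^ κ := by
        rw [Real.div_rpow hs.le hr.le, Real.rpow_neg hs.le, Real.rpow_neg hr.le]
        have := Real.rpow_pos_of_pos hs κ
        field_simp
      rw [e]
      gcongr
      have : 1 ≤ s / r := (one_le_div hr).2 hrs
      simpa using Real.rpow_le_rpow_of_exponent_le this h1
    have hb : (r / s) ^ m ≤ (r / s) ^ 2 := pow_le_pow_of_le_one (by positivity) ht hm
    calc r ^ (-κ) * (h₁ m r / h₁ m s) ≤ (s ^ (-κ) * (s / r)) * (2 * (r / s) ^ 2) := by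
          refine mul_le_mul ha ((h₁_div_le_of_le_one m hs hs1 hr).trans (by linarith)) ?_
            (by positivity)
          exact div_nonneg (h₁_pos m hr).le (h₁_pos m hs).le
      _ = _ := by field_simp

theorem mem_uIoc_one_cases {r s : ℝ} (h : s ∈ uIoc 1 r) :
    (1 < s ∧ s ≤ r) ∨ (r < s ∧ s ≤ 1) := by
  rcases mem_uIoc.1 h with h | h
  · exact Or.inl h
  · exact Or.inr h

/-- The weighted pointwise estimate for `z` in terms of `z 1` and `linOp m z`. -/
theorem LocallyAC.weighted_enorm_le {z : ℝ → ℂ} (hz : LocallyAC z) {m : ℕ} (hm : 2 ≤ m) {κ : ℝ}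
    (h0 : 0 ≤ κ) (h1 : κ ≤ 1) {r : ℝ} (hr : 0 < r) :
    ENNReal.ofReal (r ^ (-κ)) * ‖z r‖ₑ ≤ 2 * ‖z 1‖ₑ * ENNReal.ofReal (scaleKernel r 1) +
      2 * ∫⁻ s in uIoc 1 r, ENNReal.ofReal (scaleKernel r s) *
        (ENNReal.ofReal (s ^ (-κ)) * ‖(s : ℂ) * linOp m z s‖ₑ) ∂logMeasure := by
  have hrp : 0 ≤ r ^ (-κ) := Real.rpow_nonneg hr.le _
  have hz1 : ‖z r‖ₑ ≤ ‖(h₁ m r : ℂ) * z 1‖ₑ + ‖z r - h₁ m r * z 1‖ₑ := by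
    refine le_trans (le_of_eq ?_) (enorm_add_le _ _)
    congr 1; ring
  have hA : ENNReal.ofReal (r ^ (-κ)) * ‖(h₁ m r : ℂ) * z 1‖ₑ ≤
      2 * ‖z 1‖ₑ * ENNReal.ofReal (scaleKernel r 1) := by
    have hk := rpow_neg_mul_h₁_div_le hm h0 h1 hr one_pos
      ((le_total 1 r).imp (fun h => ⟨le_rfl, h⟩) fun h => ⟨h, le_rfl⟩)
    rw [h₁_one, div_one, Real.one_rpow, mul_one] at hk
    rw [enorm_mul, ← mul_assoc, ← ofReal_norm (h₁ m r : ℂ), Complex.norm_real,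
      Real.norm_of_nonneg (h₁_pos m hr).le, ← ENNReal.ofReal_mul hrp, mul_right_comm]
    gcongr
    refine (ENNReal.ofReal_le_ofReal hk).trans_eq ?_
    rw [ENNReal.ofReal_mul zero_le_two, ENNReal.ofReal_ofNat]
  have hB : ENNReal.ofReal (r ^ (-κ)) * ‖z r - h₁ m r * z 1‖ₑ ≤
      2 * ∫⁻ s in uIoc 1 r, ENNReal.ofReal (scaleKernel r s) *
        (ENNReal.ofReal (s ^ (-κ)) * ‖(s : ℂ) * linOp m z s‖ₑ) ∂logMeasure := by
    calc _ ≤ ENNReal.ofReal (r ^ (-κ)) * ∫⁻ s in uIoc 1 r,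
          ENNReal.ofReal (h₁ m r / h₁ m s) * ‖(s : ℂ) * linOp m z s‖ₑ ∂logMeasure := by
          gcongr; exact hz.enorm_sub_h₁_mul_le m hr
      _ ≤ _ := by
          rw [← lintegral_const_mul' _ _ ENNReal.ofReal_ne_top,
            ← lintegral_const_mul' _ _ ENNReal.ofNat_ne_top]
          refine setLIntegral_mono' measurableSet_uIoc fun s hs => ?_
          have hs0 : 0 < s := uIoc_one_subset hr hs
          rw [← mul_assoc, ← mul_assoc, ← mul_assoc, ← ENNReal.ofReal_mul hrp]
          refine mul_le_mul_left (le_trans (ENNReal.ofReal_le_ofReal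
            (rpow_neg_mul_h₁_div_le hm h0 h1 hr hs0 ((mem_uIoc_one_cases hs).imp
              (fun h => ⟨h.1.le, h.2⟩) fun h => ⟨h.1.le, h.2⟩))) (le_of_eq ?_)) _
          rw [ENNReal.ofReal_mul zero_le_two, ENNReal.ofReal_ofNat,
            ENNReal.ofReal_mul (scaleKernel_nonneg hr hs0), mul_assoc]
  calc _ ≤ ENNReal.ofReal (r ^ (-κ)) * (‖(h₁ m r : ℂ) * z 1‖ₑ + ‖z r - h₁ m r * z 1‖ₑ) := by
        gcongr
    _ ≤ _ := by rw [mul_add]; exact add_le_add hA hB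

/-- The absorption step. Finiteness of `x` is essential, which is why the estimates are first made
on compact windows. -/
theorem le_two_mul_of_le_add_half {x a : ℝ≥0∞} (hx : x ≠ ∞) (h : x ≤ a + x / 2) :
    x ≤ 2 * a := by
  rcases eq_or_ne a ∞ with rfl | ha
  · simp
  lift x to NNReal using hx
  lift a to NNReal using ha
  have h2 : (x : ℝ≥0∞) / 2 = ((x / 2 : NNReal) : ℝ≥0∞) := by simp
  rw [h2] at h
  norm_cast at h ⊢
  have h' : (x : ℝ) ≤ a + x / 2 := by exact_mod_cast h
  have : (x : ℝ) ≤ 2 * a := by linarith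
  exact_mod_cast this

/-- The kernel is at most `1`, so its `p`-th power is at most itself; the resulting constant is
independent of `p`. -/
theorem lnorm_scaleKernel_one_le {p : ℝ} (hp : 1 ≤ p) (S : Set ℝ) :
    lnorm p (logMeasure.restrict S) (fun r => ENNReal.ofReal (scaleKernel r 1)) ≤ 2 := by
  refine (lnorm_restrict_le (by linarith) S _).trans ?_
  have h : ∫⁻ r, ENNReal.ofReal (scaleKernel r 1) ^ p ∂logMeasure ≤ 2 := by
    refine le_trans (lintegral_mono_ae ?_) (lintegral_scaleKernel_le one_pos)
    filter_upwards [ae_logMeasure_pos] with r hr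
    rw [scaleKernel_comm]
    refine (ENNReal.rpow_le_rpow_of_exponent_ge ?_ hp).trans_eq (ENNReal.rpow_one _)
    exact ENNReal.ofReal_le_one.2 (scaleKernel_le_one one_pos hr)
  calc _ ≤ (2 : ℝ≥0∞) ^ (1 / p) := ENNReal.rpow_le_rpow h (by positivity)
    _ ≤ (2 : ℝ≥0∞) ^ (1 : ℝ) := by
        refine ENNReal.rpow_le_rpow_of_exponent_le one_le_two ?_
        rw [div_le_one (by linarith)]
        exact hp
    _ = 2 := ENNReal.rpow_one _

theorem logMeasure_Ioo_lt_top {δ : ℝ} (hδ : 0 < δ) : logMeasure (Ioo δ δ⁻¹) < ∞ := by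
  have hs : Ioo δ δ⁻¹ ⊆ Ioi 0 := fun s hs => hδ.trans hs.1
  rw [← setLIntegral_one, setLIntegral_logMeasure measurableSet_Ioo hs]
  calc _ ≤ ∫⁻ s in Ioo δ δ⁻¹, ENNReal.ofReal δ⁻¹ := by
        refine setLIntegral_mono' measurableSet_Ioo fun s hs => ?_
        rw [mul_one]
        exact ENNReal.ofReal_le_ofReal (inv_anti₀ hδ hs.1.le)
    _ < ∞ := by
        rw [setLIntegral_const, Real.volume_Ioo]
        exact ENNReal.mul_lt_top ENNReal.ofReal_lt_top ENNReal.ofReal_lt_top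

/-- The window contains the base point `1`, so variation of constants never leaves it. This allows
the estimate to be localized. -/
theorem uIoc_one_subset_Ioo {δ r : ℝ} (hδ : 0 < δ) (hδ1 : δ < 1) (hr : r ∈ Ioo δ δ⁻¹) :
    uIoc 1 r ⊆ Ioo δ δ⁻¹ := by
  intro s hs
  have h1 : 1 < δ⁻¹ := (one_lt_inv₀ hδ).2 hδ1
  rcases mem_uIoc_one_cases hs with h | h
  · exact ⟨by linarith, h.2.trans_lt hr.2⟩
  · exact ⟨hr.1.trans h.1, h.2.trans_lt h1⟩

/-- The weighted `L^p` bound for `z` on `(δ, 1 / δ)`, with a perturbation of the right-hand side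
absorbed. -/
theorem LocallyAC.lnorm_restrict_le {z : ℝ → ℂ} (hz : LocallyAC z) {m : ℕ} (hm : 2 ≤ m) {κ p : ℝ}
    (h0 : 0 ≤ κ) (h1 : κ ≤ 1) (hp : 1 < p) {M : ℝ} (hM : ∀ r, 0 < r → ‖z r‖ ≤ M)
    {G : ℝ → ℝ≥0∞} (hG : AEMeasurable G logMeasure) {A : ℝ≥0∞} (hA : 8 * A ≤ 1)
    (hg : ∀ᵐ s : ℝ ∂logMeasure, ‖(s : ℂ) * linOp m z s‖ₑ ≤ G s + A * ‖z s‖ₑ)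
    {δ : ℝ} (hδ : 0 < δ) (hδ1 : δ < 1) :
    lnorm p (logMeasure.restrict (Ioo δ δ⁻¹)) (fun r => ENNReal.ofReal (r ^ (-κ)) * ‖z r‖ₑ) ≤
      8 * (‖z 1‖ₑ + lnorm p logMeasure (fun r => ENNReal.ofReal (r ^ (-κ)) * G r)) := by
  set S := Ioo δ δ⁻¹ with hS
  have hSm : MeasurableSet S := measurableSet_Ioo
  set μ := logMeasure.restrict S with hμ
  have hμle : μ ≤ logMeasure := Measure.restrict_le_self
  have hp0 : 0 < p := by linarith
  have hAt : A ≠ ∞ := by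
    rintro rfl
    simp at hA
  have hzm := hz.aemeasurable.mono_measure hμle
  have hGm := hG.mono_measure hμle
  have hLm := (hz.aemeasurable_linOp m).mono_measure hμle
  set X := lnorm p μ (fun r => ENNReal.ofReal (r ^ (-κ)) * ‖z r‖ₑ) with hX
  set B := lnorm p logMeasure (fun r => ENNReal.ofReal (r ^ (-κ)) * G r) with hB
  set g : ℝ → ℝ≥0∞ := fun s => ENNReal.ofReal (s ^ (-κ)) * ‖(s : ℂ) * linOp m z s‖ₑ with hgdef
  have hgm : AEMeasurable g μ := by
    have : Measurable fun s : ℝ => (s : ℂ) := Complex.measurable_ofReal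
    exact AEMeasurable.mul (by fun_prop) (this.aemeasurable.mul hLm).enorm
  have hμS : ∀ᵐ r ∂μ, r ∈ S := ae_restrict_mem hSm
  have hpt : ∀ᵐ r ∂μ, ENNReal.ofReal (r ^ (-κ)) * ‖z r‖ₑ ≤
      2 * ‖z 1‖ₑ * ENNReal.ofReal (scaleKernel r 1) +
        2 * ∫⁻ s, ENNReal.ofReal (scaleKernel r s) * g s ∂μ := by
    filter_upwards [hμS] with r hr
    refine (hz.weighted_enorm_le hm h0 h1 (hδ.trans hr.1)).trans ?_
    gcongr
    exact Measure.restrict_mono (uIoc_one_subset_Ioo hδ hδ1 hr) le_rfl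
  have hkint : ∀ᵐ r ∂μ, ∫⁻ s, ENNReal.ofReal (scaleKernel r s) ∂μ ≤ 2 := by
    filter_upwards [hμS] with r hr
    exact (lintegral_mono' hμle le_rfl).trans (lintegral_scaleKernel_le (hδ.trans hr.1))
  have hkint' : ∀ᵐ s ∂μ, ∫⁻ r, ENNReal.ofReal (scaleKernel r s) ∂μ ≤ 2 := by
    simpa only [scaleKernel_comm] using hkint
  have hSchur : lnorm p μ (fun r => ∫⁻ s, ENNReal.ofReal (scaleKernel r s) * g s ∂μ)
      ≤ 2 * lnorm p μ g := lnorm_lintegral_kernel_le hp measurable_scaleKernel hkint hkint' hgm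
  have hTm : AEMeasurable (fun r => ∫⁻ s, ENNReal.ofReal (scaleKernel r s) * g s ∂μ) μ :=
    (measurable_scaleKernel.aemeasurable.mul hgm.comp_snd).lintegral_prod_right'
  have hKm : Measurable fun r : ℝ => ENNReal.ofReal (scaleKernel r 1) := by
    unfold scaleKernel; fun_prop
  have hgle : lnorm p μ g ≤ B + A * X := by
    calc lnorm p μ g ≤ lnorm p μ (fun r => ENNReal.ofReal (r ^ (-κ)) * G r +
          A * (ENNReal.ofReal (r ^ (-κ)) * ‖z r‖ₑ)) := by
          refine lnorm_mono hp0.le ?_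
          filter_upwards [ae_mono hμle hg] with s hs
          calc g s ≤ ENNReal.ofReal (s ^ (-κ)) * (G s + A * ‖z s‖ₑ) := mul_le_mul_right hs _
            _ = _ := by ring
      _ ≤ lnorm p μ (fun r => ENNReal.ofReal (r ^ (-κ)) * G r) +
          lnorm p μ (fun r => A * (ENNReal.ofReal (r ^ (-κ)) * ‖z r‖ₑ)) :=
          lnorm_add_le hp.le (by fun_prop) (by fun_prop)
      _ ≤ B + A * X := by
          rw [lnorm_const_mul hp0 hAt]
          gcongr
          exact SchrodingerMap.lnorm_restrict_le hp0.le S _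
  have hXle : X ≤ 4 * ‖z 1‖ₑ + 4 * (B + A * X) := by
    calc X ≤ lnorm p μ (fun r => 2 * ‖z 1‖ₑ * ENNReal.ofReal (scaleKernel r 1) +
          2 * ∫⁻ s, ENNReal.ofReal (scaleKernel r s) * g s ∂μ) := lnorm_mono hp0.le hpt
      _ ≤ _ := lnorm_add_le hp.le (hKm.aemeasurable.const_mul _) (hTm.const_mul _)
      _ ≤ 2 * ‖z 1‖ₑ * 2 + 2 * (2 * (B + A * X)) := by
          rw [lnorm_const_mul hp0 (by finiteness), lnorm_const_mul hp0 (by finiteness)]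
          gcongr
          · exact lnorm_scaleKernel_one_le hp.le S
          · exact hSchur.trans (by gcongr)
      _ = _ := by ring
  -- On the window `z` and the weight are bounded and `dr/r` has finite mass, so absorption is
  -- legitimate; the final bound does not depend on `M` or `δ`.
  have hXtop : X ≠ ∞ := by
    have hb : ∀ᵐ r ∂μ, ENNReal.ofReal (r ^ (-κ)) * ‖z r‖ₑ ≤
        ENNReal.ofReal (δ ^ (-κ)) * ENNReal.ofReal M := by
      filter_upwards [hμS] with r hr
      have hr0 := hδ.trans hr.1
      rw [← ofReal_norm]
      gcongr ENNReal.ofReal ?_ * ENNReal.ofReal ?_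
      · exact Real.rpow_le_rpow_of_nonpos hδ hr.1.le (by linarith)
      · exact hM r hr0
    refine ne_top_of_le_ne_top ?_ (lnorm_mono hp0.le hb)
    refine ENNReal.rpow_ne_top_of_nonneg (by positivity) ?_
    rw [lintegral_const, Measure.restrict_apply_univ]
    exact ENNReal.mul_ne_top (by finiteness) (logMeasure_Ioo_lt_top hδ).ne
  have h4 : 4 * (A * X) ≤ X / 2 := by
    rw [ENNReal.le_div_iff_mul_le (by simp) (by simp)]
    calc 4 * (A * X) * 2 = 8 * A * X := by ring
      _ ≤ 1 * X := by gcongr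
      _ = X := one_mul _
  have := le_two_mul_of_le_add_half (a := 4 * (‖z 1‖ₑ + B)) hXtop (hXle.trans (by
    calc 4 * ‖z 1‖ₑ + 4 * (B + A * X) = 4 * (‖z 1‖ₑ + B) + 4 * (A * X) := by ring
      _ ≤ _ := by gcongr))
  refine this.trans_eq ?_
  ring

/-- Monotone convergence along the windows with `δ = 1/(n+2)`, which increase to `(0, ∞)`. -/
theorem lnorm_logMeasure_le_of_Ioo {p : ℝ} (hp : 0 < p) {f : ℝ → ℝ≥0∞} {K : ℝ≥0∞}
    (h : ∀ δ : ℝ, 0 < δ → δ < 1 → lnorm p (logMeasure.restrict (Ioo δ δ⁻¹)) f ≤ K) :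
    lnorm p logMeasure f ≤ K := by
  set S : ℕ → Set ℝ := fun n => Ioo (1 / ((n : ℝ) + 2)) (1 / ((n : ℝ) + 2))⁻¹ with hS
  have hmono : Monotone S := by
    intro a b hab
    have hab' : (a : ℝ) ≤ b := by exact_mod_cast hab
    refine Ioo_subset_Ioo ?_ ?_
    · exact one_div_le_one_div_of_le (by positivity) (by linarith)
    · rw [one_div, one_div, inv_inv, inv_inv]; linarith
  have hU : ⋃ n, S n = Ioi 0 := by
    ext r
    simp only [mem_iUnion, mem_Ioi]
    constructor
    · rintro ⟨n, hn⟩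
      exact lt_trans (by positivity) hn.1
    · intro h0
      obtain ⟨n, hn⟩ := exists_nat_gt (max r (1 / r))
      have h1 : r < n := (le_max_left _ _).trans_lt hn
      have h2 : 1 / r < n := (le_max_right _ _).trans_lt hn
      refine ⟨n, ?_, ?_⟩
      · rw [div_lt_iff₀ h0] at h2
        rw [div_lt_iff₀ (by positivity)]
        nlinarith
      · rw [one_div, inv_inv]; linarith
  have hr : logMeasure.restrict (Ioi 0) = logMeasure :=
    Measure.restrict_eq_self_of_ae_mem ae_logMeasure_pos
  have hle : ∫⁻ r, f r ^ p ∂logMeasure ≤ K ^ p := by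
    rw [← hr, ← hU, setLIntegral_iUnion_of_directed _ hmono.directed_le]
    refine iSup_le fun n => ?_
    have hn : (0 : ℝ) ≤ n := Nat.cast_nonneg n
    have := h (1 / ((n : ℝ) + 2)) (by positivity)
      (by rw [div_lt_one (by positivity)]; linarith)
    rw [lnorm, one_div p, ENNReal.rpow_inv_le_iff hp] at this
    exact this
  rw [lnorm, one_div, ENNReal.rpow_inv_le_iff hp]
  exact hle

theorem LocallyAC.lnorm_le {z : ℝ → ℂ} (hz : LocallyAC z) {m : ℕ} (hm : 2 ≤ m) {κ p : ℝ}
    (h0 : 0 ≤ κ) (h1 : κ ≤ 1) (hp : 1 < p) {M : ℝ} (hM : ∀ r, 0 < r → ‖z r‖ ≤ M)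
    {G : ℝ → ℝ≥0∞} (hG : AEMeasurable G logMeasure) {A : ℝ≥0∞} (hA : 8 * A ≤ 1)
    (hg : ∀ᵐ s : ℝ ∂logMeasure, ‖(s : ℂ) * linOp m z s‖ₑ ≤ G s + A * ‖z s‖ₑ) :
    lnorm p logMeasure (fun r => ENNReal.ofReal (r ^ (-κ)) * ‖z r‖ₑ) ≤
      8 * (‖z 1‖ₑ + lnorm p logMeasure (fun r => ENNReal.ofReal (r ^ (-κ)) * G r)) :=
  lnorm_logMeasure_le_of_Ioo (by linarith) fun _ hδ hδ1 =>
    hz.lnorm_restrict_le hm h0 h1 hp hM hG hA hg hδ hδ1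

/-! ### The orthogonality condition and the value at `1`. -/

/-- The weight `min (s, s^{2 - m})` that controls the value at `1` of a function orthogonal
to `h₁`. -/
noncomputable def tailWeight (m : ℕ) (s : ℝ) : ℝ := if s ≤ 1 then s else s ^ (2 - m : ℝ)

theorem measurable_tailWeight (m : ℕ) : Measurable (tailWeight m) := by
  unfold tailWeight
  exact Measurable.ite measurableSet_Iic measurable_id (by fun_prop)

theorem tailWeight_pos (m : ℕ) {s : ℝ} (hs : 0 < s) : 0 < tailWeight m s := by
  unfold tailWeight
  split_ifs
  · exact hs
  · positivity

theorem h₁_le_of_one_le (m : ℕ) {r : ℝ} (hr : 0 < r) : h₁ m r ≤ 2 * (1 / r) ^ m := by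
  have := h₁_div_le_of_one_le m (le_refl (1 : ℝ)) hr
  rwa [h₁_one, div_one] at this

theorem h₁_le_two_mul_pow (m : ℕ) {r : ℝ} (hr : 0 < r) : h₁ m r ≤ 2 * r ^ m := by
  have := h₁_div_le_of_le_one m one_pos le_rfl hr
  rwa [h₁_one, div_one, div_one] at this

/-- For `1 < s ≤ r` the left side is at most `4 r^{2-2m} s^m = 4 s^{2-m} (s/r)^{2m-2}`; for `r < s ≤
1` spare powers of `r` supply the factor `s`. Factoring out the invariant kernel lets the
`r`-integral be done first. -/
theorem h₁_kernel_le {m : ℕ} (hm : 2 ≤ m) {r s : ℝ} (hr : 0 < r) (hs : 0 < s)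
    (hrs : (1 < s ∧ s ≤ r) ∨ (r < s ∧ s ≤ 1)) :
    r ^ 2 * h₁ m r * (h₁ m r / h₁ m s) ≤ 4 * (tailWeight m s * scaleKernel r s) := by
  have hq : 0 ≤ h₁ m r / h₁ m s := div_nonneg (h₁_pos m hr).le (h₁_pos m hs).le
  rcases hrs with ⟨hs1, hsr⟩ | ⟨hrs, hs1⟩
  · rw [scaleKernel_of_le hs hsr, tailWeight, if_neg (not_le.2 hs1), Real.rpow_sub hs,
      Real.rpow_two, Real.rpow_natCast]
    have ht : s / r ≤ 1 := div_le_one_of_le₀ hsr hr.le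
    calc r ^ 2 * h₁ m r * (h₁ m r / h₁ m s) ≤ r ^ 2 * (2 * (1 / r) ^ m) * (2 * (s / r) ^ m) := by
          gcongr
          · exact h₁_le_of_one_le m hr
          · exact h₁_div_le_of_one_le m hs1.le hr
      _ = 4 * (s ^ 2 / s ^ m * (s / r) ^ (m + m - 2)) := by
          have e : (s / r) ^ (m + m - 2) = (s / r) ^ m * (s / r) ^ m / (s / r) ^ 2 := by
            rw [pow_sub₀ _ (by positivity) (by omega), pow_add]
            field_simp
          rw [e, div_pow, div_pow, div_pow, one_pow]
          field_simp
          ring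
      _ ≤ 4 * (s ^ 2 / s ^ m * (s / r)) := by
          gcongr
          exact pow_le_of_le_one (by positivity) ht (by omega)
  · rw [scaleKernel_of_ge hr hrs.le, tailWeight, if_pos hs1]
    have ht : r / s ≤ 1 := div_le_one_of_le₀ hrs.le hs.le
    have hr1 : r ≤ 1 := hrs.le.trans hs1
    calc r ^ 2 * h₁ m r * (h₁ m r / h₁ m s) ≤ r ^ 2 * (2 * r ^ m) * (2 * (r / s) ^ m) := by
          gcongr
          · exact h₁_le_two_mul_pow m hr
          · exact h₁_div_le_of_le_one m hs hs1 hr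
      _ = 4 * (r ^ (2 + m) * (r / s) ^ m) := by ring
      _ ≤ 4 * (s * (r / s)) := by
          gcongr
          · exact (pow_le_of_le_one hr.le hr1 (by omega)).trans hrs.le
          · exact pow_le_of_le_one (by positivity) ht (by omega)

/-- At infinity `r² h₁` decays like `r^{2-m}`, so `m ≥ 3` leaves one power. This makes the pairing
of `h₁` with a merely bounded function in `r dr` converge absolutely. -/
theorem sq_mul_h₁_le {m : ℕ} (hm : 3 ≤ m) {r : ℝ} (hr : 0 < r) :
    r ^ 2 * h₁ m r ≤ 2 * scaleKernel 1 r := by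
  rcases le_total 1 r with h | h
  · rw [scaleKernel_of_ge one_pos h]
    have h1 : 1 / r ≤ 1 := (div_le_one hr).2 h
    calc r ^ 2 * h₁ m r ≤ r ^ 2 * (2 * (1 / r) ^ m) := by gcongr; exact h₁_le_of_one_le m hr
      _ ≤ r ^ 2 * (2 * (1 / r) ^ 3) := by
          gcongr ?_ * (2 * ?_)
          exact pow_le_pow_of_le_one (by positivity) h1 hm
      _ = 2 * (1 / r) := by field_simp
  · rw [scaleKernel_of_le hr h, div_one]
    calc r ^ 2 * h₁ m r ≤ 1 * (2 * r ^ m) := by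
          refine mul_le_mul (pow_le_one₀ hr.le h) (h₁_le_two_mul_pow m hr) (h₁_pos m hr).le
            zero_le_one
      _ ≤ 2 * r := by
          rw [one_mul]
          gcongr
          exact pow_le_of_le_one hr.le h (by omega)

theorem integrableOn_h₁_mul {m : ℕ} (hm : 3 ≤ m) :
    IntegrableOn (fun r => h₁ m r * r) (Ioi 0) := by
  refine ⟨((measurable_h₁ m).mul measurable_id).aestronglyMeasurable, ?_⟩
  have e : ∫⁻ r in Ioi (0 : ℝ), ‖h₁ m r * r‖ₑ ≤
      ∫⁻ r, 2 * ENNReal.ofReal (scaleKernel 1 r) ∂logMeasure := by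
    rw [lintegral_logMeasure]
    refine setLIntegral_mono' measurableSet_Ioi fun r (hr : 0 < r) => ?_
    have h1 := h₁_pos m hr
    rw [Real.enorm_of_nonneg (by positivity), ← ENNReal.ofReal_ofNat 2,
      ← ENNReal.ofReal_mul zero_le_two, ← ENNReal.ofReal_mul (by positivity)]
    refine ENNReal.ofReal_le_ofReal ?_
    rw [← div_eq_inv_mul, le_div_iff₀ hr]
    have := sq_mul_h₁_le hm hr
    linarith
  refine e.trans_lt ?_
  rw [lintegral_const_mul' _ _ ENNReal.ofNat_ne_top]
  exact ENNReal.mul_lt_top (by simp) ((lintegral_scaleKernel_le one_pos).trans_lt (by simp))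

theorem integrableOn_mul_h₁_mul {m : ℕ} (hm : 3 ≤ m) {w : ℝ → ℂ} (hw : ContinuousOn w (Ioi 0))
    {M : ℝ} (hM : ∀ r, 0 < r → ‖w r‖ ≤ M) :
    IntegrableOn (fun r => w r * (h₁ m r : ℂ) * (r : ℂ)) (Ioi 0) := by
  have h := (integrableOn_h₁_mul hm).ofReal (𝕜 := ℂ)
  have h2 := h.bdd_mul (c := M) (hw.aestronglyMeasurable measurableSet_Ioi)
    ((ae_restrict_iff' measurableSet_Ioi).2 (Eventually.of_forall fun r hr => hM r hr))
  refine h2.congr (Eventually.of_forall fun r => ?_)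
  simp [mul_assoc]

theorem integral_h₁_sq_pos {m : ℕ} (hm : 3 ≤ m) :
    0 < ∫ r in Ioi (0 : ℝ), h₁ m r * h₁ m r * r := by
  have hint : IntegrableOn (fun r => h₁ m r * h₁ m r * r) (Ioi 0) := by
    refine (integrableOn_h₁_mul hm).mono'
      (((measurable_h₁ m).mul (measurable_h₁ m)).mul measurable_id).aestronglyMeasurable ?_
    refine (ae_restrict_iff' measurableSet_Ioi).2 (Eventually.of_forall fun r (hr : 0 < r) => ?_)
    have h1 := h₁_pos m hr
    rw [Real.norm_of_nonneg (by positivity)]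
    have := h₁_le_one m hr
    have : h₁ m r * h₁ m r ≤ h₁ m r := mul_le_of_le_one_left h1.le this
    gcongr
  rw [setIntegral_pos_iff_support_of_nonneg_ae _ hint]
  · have : Function.support (fun r => h₁ m r * h₁ m r * r) ∩ Ioi 0 = Ioi 0 := by
      refine inter_eq_right.2 fun r (hr : 0 < r) => ?_
      have h1 := h₁_pos m hr
      rw [Function.mem_support]
      positivity
    rw [this]
    simp
  · refine (ae_restrict_iff' measurableSet_Ioi).2 (Eventually.of_forall fun r (hr : 0 < r) => ?_)
    have h1 := h₁_pos m hr
    simp only [Pi.zero_apply]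
    positivity

/-- The orthogonality condition controls `z 1`. -/
theorem LocallyAC.enorm_apply_one_le {z : ℝ → ℂ} (hz : LocallyAC z) {m : ℕ} (hm : 3 ≤ m) {M : ℝ}
    (hM : ∀ r, 0 < r → ‖z r‖ ≤ M) (ho : IsOrthogonal m z) :
    ENNReal.ofReal (∫ r in Ioi (0 : ℝ), h₁ m r * h₁ m r * r) * ‖z 1‖ₑ ≤
      8 * ∫⁻ s, ENNReal.ofReal (tailWeight m s) * ‖(s : ℂ) * linOp m z s‖ₑ ∂logMeasure := by
  set I := ∫ r in Ioi (0 : ℝ), h₁ m r * h₁ m r * r with hI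
  have hIpos : 0 < I := integral_h₁_sq_pos hm
  have hcont : ContinuousOn (fun r => (h₁ m r : ℂ)) (Ioi 0) := fun r hr =>
    (Complex.continuous_ofReal.continuousAt.comp
      (hasDerivAt_h₁ m hr).continuousAt).continuousWithinAt
  have i1 := integrableOn_mul_h₁_mul hm hz.continuousOn hM
  have i2 := integrableOn_mul_h₁_mul hm (w := fun r => (h₁ m r : ℂ) * z 1) (M := ‖z 1‖)
    (hcont.mul continuousOn_const) (fun r hr => by
      rw [norm_mul, Complex.norm_real, Real.norm_of_nonneg (h₁_pos m hr).le]
      exact mul_le_of_le_one_left (norm_nonneg _) (h₁_le_one m hr))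
  -- Orthogonality removes the `z` term, so the pairing of the variation of constants remainder with
  -- `h₁` isolates `z(1)`.
  have e1 : ∫ r in Ioi (0 : ℝ), (z r - h₁ m r * z 1) * (h₁ m r : ℂ) * (r : ℂ) = -(I * z 1) := by
    have : ∀ r : ℝ, (z r - h₁ m r * z 1) * (h₁ m r : ℂ) * (r : ℂ) =
        z r * (h₁ m r : ℂ) * (r : ℂ) - h₁ m r * z 1 * (h₁ m r : ℂ) * (r : ℂ) := fun r => by ring
    simp_rw [this]
    rw [integral_sub i1 i2, ho, zero_sub, hI,
      show ((∫ r in Ioi (0 : ℝ), h₁ m r * h₁ m r * r : ℝ) : ℂ) =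
        ∫ r in Ioi (0 : ℝ), ((h₁ m r * h₁ m r * r : ℝ) : ℂ) from integral_ofReal.symm,
      ← integral_mul_const]
    congr 2
    ext r
    push_cast
    ring
  have hgm : AEMeasurable (fun s : ℝ => ‖(s : ℂ) * linOp m z s‖ₑ) logMeasure := by
    have : Measurable fun s : ℝ => (s : ℂ) := Complex.measurable_ofReal
    exact (this.aemeasurable.mul (hz.aemeasurable_linOp m)).enorm
  have htm := measurable_tailWeight m
  calc ENNReal.ofReal I * ‖z 1‖ₑ = ‖-((I : ℂ) * z 1)‖ₑ := by
        rw [enorm_neg, enorm_mul, ← ofReal_norm (I : ℂ), Complex.norm_real,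
          Real.norm_of_nonneg hIpos.le]
    _ ≤ ∫⁻ r in Ioi (0 : ℝ), ‖(z r - h₁ m r * z 1) * (h₁ m r : ℂ) * (r : ℂ)‖ₑ := by
        rw [← e1]; exact enorm_integral_le_lintegral_enorm _
    _ = ∫⁻ r, ENNReal.ofReal (r ^ 2 * h₁ m r) * ‖z r - h₁ m r * z 1‖ₑ ∂logMeasure := by
        rw [lintegral_logMeasure]
        refine setLIntegral_congr_fun measurableSet_Ioi fun r (hr : 0 < r) => ?_
        have h1 := h₁_pos m hr
        rw [← mul_assoc, ← ENNReal.ofReal_mul (by positivity), enorm_mul, enorm_mul,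
          ← ofReal_norm (h₁ m r : ℂ), ← ofReal_norm (r : ℂ), Complex.norm_real, Complex.norm_real,
          Real.norm_of_nonneg h1.le, Real.norm_of_nonneg hr.le, mul_assoc,
          ← ENNReal.ofReal_mul h1.le, mul_comm]
        congr 2
        field_simp
    _ ≤ ∫⁻ r, ∫⁻ s, 4 * (ENNReal.ofReal (scaleKernel r s) * (ENNReal.ofReal (tailWeight m s) *
          ‖(s : ℂ) * linOp m z s‖ₑ)) ∂logMeasure ∂logMeasure := by
        refine lintegral_mono_ae ?_
        filter_upwards [ae_logMeasure_pos] with r hr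
        have h1 := h₁_pos m hr
        calc _ ≤ ENNReal.ofReal (r ^ 2 * h₁ m r) * ∫⁻ s in uIoc 1 r,
              ENNReal.ofReal (h₁ m r / h₁ m s) * ‖(s : ℂ) * linOp m z s‖ₑ ∂logMeasure := by
              gcongr; exact hz.enorm_sub_h₁_mul_le m hr
          _ ≤ ∫⁻ s in uIoc 1 r, 4 * (ENNReal.ofReal (scaleKernel r s) *
              (ENNReal.ofReal (tailWeight m s) * ‖(s : ℂ) * linOp m z s‖ₑ)) ∂logMeasure := by
              rw [← lintegral_const_mul' _ _ ENNReal.ofReal_ne_top]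
              refine setLIntegral_mono' measurableSet_uIoc fun s hs => ?_
              have hs0 : 0 < s := uIoc_one_subset hr hs
              rw [← mul_assoc, ← mul_assoc, ← mul_assoc, ← ENNReal.ofReal_mul (by positivity)]
              refine mul_le_mul_left ((ENNReal.ofReal_le_ofReal (h₁_kernel_le (by omega) hr hs0
                (mem_uIoc_one_cases hs))).trans_eq ?_) _
              rw [ENNReal.ofReal_mul (by norm_num), ENNReal.ofReal_ofNat,
                ENNReal.ofReal_mul (tailWeight_pos m hs0).le, mul_assoc,
                mul_comm (ENNReal.ofReal (tailWeight m s))]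
          _ ≤ _ := setLIntegral_le_lintegral _ _
    -- After Tonelli the `r`-integral of the kernel is at most `2`, which gives `4 · 2 = 8`.
    _ = ∫⁻ s, ∫⁻ r, 4 * (ENNReal.ofReal (scaleKernel r s) * (ENNReal.ofReal (tailWeight m s) *
          ‖(s : ℂ) * linOp m z s‖ₑ)) ∂logMeasure ∂logMeasure := by
        refine lintegral_lintegral_swap (AEMeasurable.const_mul
          (measurable_scaleKernel.aemeasurable.mul ?_) _)
        exact (AEMeasurable.mul htm.ennreal_ofReal.aemeasurable hgm).comp_snd
    _ ≤ ∫⁻ s, 8 * (ENNReal.ofReal (tailWeight m s) * ‖(s : ℂ) * linOp m z s‖ₑ) ∂logMeasure := by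
        refine lintegral_mono_ae ?_
        filter_upwards [ae_logMeasure_pos] with s hs
        have hk : Measurable fun r : ℝ => ENNReal.ofReal (scaleKernel r s) := by
          unfold scaleKernel; fun_prop
        rw [lintegral_const_mul' _ _ ENNReal.ofNat_ne_top, lintegral_mul_const _ hk]
        have : ∫⁻ r, ENNReal.ofReal (scaleKernel r s) ∂logMeasure ≤ 2 := by
          simp_rw [scaleKernel_comm _ s]; exact lintegral_scaleKernel_le hs
        calc _ ≤ 4 * (2 * (ENNReal.ofReal (tailWeight m s) * ‖(s : ℂ) * linOp m z s‖ₑ)) := by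
              gcongr
          _ = _ := by ring
    _ = _ := lintegral_const_mul' _ _ ENNReal.ofNat_ne_top

/-! ### The nonlinear terms. -/

/-- The nonlinear part of the equation satisfied by the perturbation `z`. -/
noncomputable def nonlin (m : ℕ) (z : ℝ → ℂ) (r : ℝ) : ℂ :=
  ((h₃ m r * normalPart (z r) + (z r).im * h₁ m r : ℝ) : ℂ) * z r +
    ((normalPart (z r) * h₁ m r : ℝ) : ℂ) * Complex.I

/-- The left-hand side `z' + (m / r) (h₃ z + N(z))` of the equation satisfied by `z`. -/
noncomputable def fullOp (m : ℕ) (z : ℝ → ℂ) (r : ℝ) : ℂ :=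
  linOp m z r + ((m / r : ℝ) : ℂ) * nonlin m z r

theorem abs_normalPart_le {w : ℂ} (hw : ‖w‖ ≤ 1) : |normalPart w| ≤ ‖w‖ ^ 2 := by
  have h0 : 0 ≤ ‖w‖ ^ 2 := by positivity
  have h1 : ‖w‖ ^ 2 ≤ 1 := pow_le_one₀ (norm_nonneg _) hw
  have h2 : 1 - ‖w‖ ^ 2 ≤ √(1 - ‖w‖ ^ 2) := Real.le_sqrt_of_sq_le (by nlinarith)
  have h3 : √(1 - ‖w‖ ^ 2) ≤ 1 := Real.sqrt_le_one.2 (by linarith)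
  rw [normalPart, abs_le]
  constructor <;> linarith

/-- Every term is at least quadratic in `z`, and the purely quadratic ones carry a factor `h₁`.
Without that factor the coefficient would not be integrable in `dr/r`, as `|z|²` is but `|z|` need
not be. -/
theorem norm_nonlin_le (m : ℕ) {z : ℝ → ℂ} {r : ℝ} (hr : 0 < r) (hz : ‖z r‖ ≤ 1) :
    ‖nonlin m z r‖ ≤ (‖z r‖ ^ 2 + 2 * h₁ m r * ‖z r‖) * ‖z r‖ := by
  have hγ := abs_normalPart_le hz
  have h1 := h₁_pos m hr
  have h3 := abs_h₃_le_one m hr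
  have him := Complex.abs_im_le_norm (z r)
  have ha : |h₃ m r * normalPart (z r) + (z r).im * h₁ m r| ≤ ‖z r‖ ^ 2 + h₁ m r * ‖z r‖ := by
    refine (abs_add_le _ _).trans (add_le_add ?_ ?_)
    · rw [abs_mul]
      exact (mul_le_of_le_one_left (abs_nonneg _) h3).trans hγ
    · rw [abs_mul, abs_of_pos h1, mul_comm]
      gcongr
  refine (norm_add_le _ _).trans ?_
  rw [norm_mul, norm_mul, Complex.norm_I, mul_one, Complex.norm_real, Complex.norm_real,
    Real.norm_eq_abs, Real.norm_eq_abs, abs_mul (normalPart _), abs_of_pos h1]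
  calc _ ≤ (‖z r‖ ^ 2 + h₁ m r * ‖z r‖) * ‖z r‖ + ‖z r‖ ^ 2 * h₁ m r := by gcongr
    _ = _ := by ring

theorem enorm_mul_linOp_le (m : ℕ) {z : ℝ → ℂ} {r : ℝ} (hr : 0 < r) (hz : ‖z r‖ ≤ 1) :
    ‖(r : ℂ) * linOp m z r‖ₑ ≤ ‖(r : ℂ) * fullOp m z r‖ₑ +
      m * (ENNReal.ofReal (‖z r‖ ^ 2 + 2 * h₁ m r * ‖z r‖) * ‖z r‖ₑ) := by
  have h1 := h₁_pos m hr
  have hr' : (r : ℂ) ≠ 0 := by exact_mod_cast hr.ne'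
  have e : (r : ℂ) * linOp m z r = (r : ℂ) * fullOp m z r - m * nonlin m z r := by
    rw [fullOp]; push_cast; field_simp; ring
  rw [e]
  refine (enorm_sub_le).trans (add_le_add le_rfl ?_)
  rw [enorm_mul]
  have hm : ‖(m : ℂ)‖ₑ = m := by
    rw [← ofReal_norm, Complex.norm_natCast, ENNReal.ofReal_natCast]
  rw [hm]
  gcongr
  rw [← ofReal_norm, ← ofReal_norm, ← ENNReal.ofReal_mul (by positivity)]
  exact ENNReal.ofReal_le_ofReal (norm_nonlin_le m hr hz)

theorem LocallyAC.aemeasurable_nonlin {z : ℝ → ℂ} (hz : LocallyAC z) (m : ℕ) :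
    AEMeasurable (nonlin m z) logMeasure := by
  have h := hz.aemeasurable
  have h1 := measurable_h₁ m
  have h3 := measurable_h₃ m
  have hn : AEMeasurable (fun r => normalPart (z r)) logMeasure := by
    unfold normalPart; fun_prop
  have hre : AEMeasurable (fun r => h₃ m r * normalPart (z r) + (z r).im * h₁ m r) logMeasure := by
    have := Complex.measurable_im.comp_aemeasurable h
    exact (h3.aemeasurable.mul hn).add (this.mul h1.aemeasurable)
  exact ((Complex.measurable_ofReal.comp_aemeasurable hre).mul h).add
    ((Complex.measurable_ofReal.comp_aemeasurable (hn.mul h1.aemeasurable)).mul_const _)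

theorem LocallyAC.aemeasurable_fullOp {z : ℝ → ℂ} (hz : LocallyAC z) (m : ℕ) :
    AEMeasurable (fullOp m z) logMeasure := by
  have h : Measurable fun r : ℝ => ((m / r : ℝ) : ℂ) :=
    Complex.measurable_ofReal.comp (by fun_prop)
  exact (hz.aemeasurable_linOp m).add (h.aemeasurable.mul (hz.aemeasurable_nonlin m))

theorem h₁_le_scaleKernel {m : ℕ} (hm : 2 ≤ m) {r : ℝ} (hr : 0 < r) :
    h₁ m r ≤ 2 * scaleKernel 1 r := by
  have hk := rpow_neg_mul_h₁_div_le hm le_rfl zero_le_one hr one_pos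
    ((le_total 1 r).imp (fun h => ⟨le_rfl, h⟩) fun h => ⟨h, le_rfl⟩)
  simpa [h₁_one, scaleKernel_comm r 1] using hk

/-- The `|z|²` part is bounded by the energy, the `h₁ |z|` part by the supremum bound and the
integrability of `h₁`; in total `ε² + 24 ε`. -/
theorem lintegral_coefficient_le {m : ℕ} (hm : 2 ≤ m) {z : ℝ → ℂ} {ε : ℝ} (hε : 0 < ε)
    (hε1 : ε ≤ 1) (hx : xNorm z ≤ ENNReal.ofReal ε) (hz : ∀ r, 0 < r → ‖z r‖ ≤ 3 * ε) :
    ∫⁻ r, ENNReal.ofReal (‖z r‖ ^ 2 + 2 * h₁ m r * ‖z r‖) ∂logMeasure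
      ≤ ENNReal.ofReal (25 * ε) := by
  calc _ ≤ ∫⁻ r, (ENNReal.ofReal (‖z r‖ ^ 2) +
        ENNReal.ofReal (12 * ε) * ENNReal.ofReal (scaleKernel 1 r)) ∂logMeasure := by
        refine lintegral_mono_ae ?_
        filter_upwards [ae_logMeasure_pos] with r hr
        have hk := scaleKernel_nonneg one_pos hr
        rw [← ENNReal.ofReal_mul (by positivity), ← ENNReal.ofReal_add (by positivity)
          (by positivity)]
        refine ENNReal.ofReal_le_ofReal (add_le_add le_rfl ?_)
        calc 2 * h₁ m r * ‖z r‖ ≤ 2 * (2 * scaleKernel 1 r) * (3 * ε) := by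
              gcongr
              · exact h₁_le_scaleKernel hm hr
              · exact hz r hr
          _ = _ := by ring
    _ ≤ ENNReal.ofReal (ε ^ 2) + ENNReal.ofReal (12 * ε) * 2 := by
        have hk : Measurable fun r : ℝ => ENNReal.ofReal (scaleKernel 1 r) := by
          unfold scaleKernel; fun_prop
        rw [lintegral_add_right _ (hk.const_mul _),
          lintegral_const_mul' _ _ ENNReal.ofReal_ne_top]
        gcongr
        · exact lintegral_sq_le hε.le hx
        · exact lintegral_scaleKernel_le one_pos
    _ ≤ ENNReal.ofReal (25 * ε) := by
        rw [← ENNReal.ofReal_ofNat 2, ← ENNReal.ofReal_mul (by positivity),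
          ← ENNReal.ofReal_add (by positivity) (by positivity)]
        refine ENNReal.ofReal_le_ofReal ?_
        nlinarith

/-! ### Integrability of the tail weight, and the absorption argument. -/

theorem tailWeight_mul_rpow_le_one {m : ℕ} {κ : ℝ} (h0 : 0 ≤ κ) (hκ : κ < m - 2) {s : ℝ}
    (hs : 0 < s) : tailWeight m s * s ^ κ ≤ 1 := by
  unfold tailWeight
  split_ifs with h
  · exact mul_le_one₀ h (Real.rpow_nonneg hs.le _) (Real.rpow_le_one hs.le h h0)
  · rw [← Real.rpow_add hs]
    exact Real.rpow_le_one_of_one_le_of_nonpos (not_le.1 h).le (by linarith)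

/-- At infinity the integrand is `s^{1-m+κ}`: this is where `κ < m - 2` is needed. -/
theorem lintegral_tailWeight_lt_top {m : ℕ} {κ : ℝ} (h0 : 0 ≤ κ) (hκ : κ < m - 2) :
    ∫⁻ s, ENNReal.ofReal (tailWeight m s * s ^ κ) ∂logMeasure < ∞ := by
  rw [lintegral_logMeasure, ← Ioc_union_Ioi_eq_Ioi zero_le_one]
  refine (lintegral_union_le _ _ _).trans_lt (ENNReal.add_lt_top.2 ⟨?_, ?_⟩)
  · calc _ ≤ ∫⁻ s in Ioc (0 : ℝ) 1, 1 := by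
          refine setLIntegral_mono' measurableSet_Ioc fun s hs => ?_
          rw [← ENNReal.ofReal_mul (inv_nonneg.2 hs.1.le), tailWeight, if_pos hs.2,
            inv_mul_cancel_left₀ hs.1.ne']
          exact ENNReal.ofReal_le_one.2 (Real.rpow_le_one hs.1.le hs.2 h0)
      _ < ∞ := by simp
  · calc _ ≤ ∫⁻ s in Ioi (1 : ℝ), ENNReal.ofReal (s ^ (1 - m + κ : ℝ)) := by
          refine setLIntegral_mono' measurableSet_Ioi fun s (hs : 1 < s) => ?_
          have hs0 : 0 < s := one_pos.trans hs
          rw [← ENNReal.ofReal_mul (inv_nonneg.2 hs0.le), tailWeight, if_neg (not_le.2 hs),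
            ← Real.rpow_neg_one, ← Real.rpow_add hs0, ← Real.rpow_add hs0]
          refine ENNReal.ofReal_le_ofReal (le_of_eq ?_)
          congr 1
          ring
      _ < ∞ := by
          rw [lintegral_Ioi_rpow (by linarith) one_pos]
          exact ENNReal.ofReal_lt_top

/-- The weighted `L^p` estimate of a small perturbation orthogonal to `h₁`. The smallness does not
depend on the weight or on `p`. -/
theorem exists_lnorm_le_fullOp {m : ℕ} (hm : 3 ≤ m) : ∃ ε : ℝ, 0 < ε ∧ 3 * ε < 1 ∧
    ∀ κ p : ℝ, 0 ≤ κ → κ ≤ 1 → κ < m - 2 → 2 ≤ p → ∃ C : ℝ, 0 < C ∧ ∀ z : ℝ → ℂ,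
      LocallyAC z → IsOrthogonal m z → xNorm z ≤ ENNReal.ofReal ε →
        lnorm p logMeasure (fun r => ENNReal.ofReal (r ^ (-κ)) * ‖z r‖ₑ) ≤ ENNReal.ofReal C *
          lnorm p logMeasure (fun r => ENNReal.ofReal (r ^ (-κ)) * ‖(r : ℂ) * fullOp m z r‖ₑ) := by
  set I := ∫ r in Ioi (0 : ℝ), h₁ m r * h₁ m r * r with hI
  have hIpos : 0 < I := integral_h₁_sq_pos hm
  have hm3 : (3 : ℝ) ≤ m := by exact_mod_cast hm
  -- The first bound gives `8 · m · 9ε ≤ 1`, to absorb in the estimate of `z`; the second gives `8 ·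
  -- m · 5η · 8 ≤ I/2`, to absorb in the estimate of `z(1)`.
  set η := min (1 / (72 * m : ℝ)) (I / (640 * m)) with hη
  have hηpos : 0 < η := lt_min (by positivity) (by positivity)
  have hη1 : 72 * m * η ≤ 1 := by
    have : η ≤ 1 / (72 * m : ℝ) := min_le_left _ _
    rw [le_div_iff₀ (by positivity)] at this
    linarith
  have hη2 : 640 * m * η ≤ I := by
    have : η ≤ I / (640 * m) := min_le_right _ _
    rw [le_div_iff₀ (by positivity)] at this
    linarith
  have hη216 : 216 * η ≤ 1 := by nlinarith
  have hεη : η ^ 2 ≤ η := by nlinarith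
  -- The threshold is a square so that `(25 ε)^{1/2} = 5 η` below. It is fixed before `κ` and `p`.
  refine ⟨η ^ 2, by positivity, by nlinarith, fun κ p h0 h1 hκ hp => ?_⟩
  obtain ⟨q, hpq⟩ : ∃ q, p.HolderConjugate q :=
    ⟨_, Real.HolderConjugate.conjExponent (by linarith)⟩
  have hq0 : 0 < q := hpq.symm.pos
  -- From `p ≥ 2`: the small factor raised to `1/q` is then at most its square root, uniformly in
  -- `p`.
  have hq2 : 1 / 2 ≤ 1 / q := by
    have h := hpq.inv_add_inv_eq_one
    have : p⁻¹ ≤ 2⁻¹ := inv_anti₀ two_pos hp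
    rw [one_div, one_div]
    linarith
  set Λ := (∫⁻ s, ENNReal.ofReal (tailWeight m s * s ^ κ) ∂logMeasure) ^ (1 / q) with hΛ
  have hΛtop : Λ ≠ ∞ :=
    ENNReal.rpow_ne_top_of_nonneg (by positivity) (lintegral_tailWeight_lt_top h0 hκ).ne
  refine ⟨8 * (16 * Λ.toReal / I + 2), by positivity, fun z hz ho hx => ?_⟩
  set ε := η ^ 2 with hε
  have hεpos : 0 < ε := by positivity
  have hM : ∀ r, 0 < r → ‖z r‖ ≤ 3 * ε := fun r hr => hz.norm_le_of_xNorm_le hεpos hx hr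
  have hz1 : ∀ r, 0 < r → ‖z r‖ ≤ 1 := fun r hr => (hM r hr).trans (by nlinarith)
  set b : ℝ → ℝ≥0∞ := fun r => ENNReal.ofReal (‖z r‖ ^ 2 + 2 * h₁ m r * ‖z r‖) with hb
  set G : ℝ → ℝ≥0∞ := fun r => ‖(r : ℂ) * fullOp m z r‖ₑ with hG
  have hzm := hz.aemeasurable
  have hofReal : Measurable fun s : ℝ => (s : ℂ) := Complex.measurable_ofReal
  have hGm : AEMeasurable G logMeasure :=
    (hofReal.aemeasurable.mul (hz.aemeasurable_fullOp m)).enorm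
  have hbm : AEMeasurable b logMeasure := by
    have := measurable_h₁ m
    fun_prop
  -- With `|z| ≤ 1` and `h₁ ≤ 1` the coefficient is at most `3 |z|`, and `|z| ≤ 3ε`.
  have hb9 : ∀ r, 0 < r → ‖z r‖ ^ 2 + 2 * h₁ m r * ‖z r‖ ≤ 9 * ε := by
    intro r hr
    have a1 := hM r hr
    have a2 := hz1 r hr
    have a3 := h₁_le_one m hr
    have a4 := norm_nonneg (z r)
    nlinarith [mul_nonneg a4 (sub_nonneg.2 a3), mul_nonneg a4 (sub_nonneg.2 a2)]
  set X := lnorm p logMeasure (fun r => ENNReal.ofReal (r ^ (-κ)) * ‖z r‖ₑ) with hX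
  set B := lnorm p logMeasure (fun r => ENNReal.ofReal (r ^ (-κ)) * G r) with hB
  have hg1 : ∀ᵐ s : ℝ ∂logMeasure,
      ‖(s : ℂ) * linOp m z s‖ₑ ≤ G s + m * (b s * ‖z s‖ₑ) := by
    filter_upwards [ae_logMeasure_pos] with s hs
    exact enorm_mul_linOp_le m hs (hz1 s hs)
  have hXle : X ≤ 8 * (‖z 1‖ₑ + B) := by
    refine hz.lnorm_le (le_of_lt hm) h0 h1 (by linarith) hM hGm
      (A := ENNReal.ofReal (m * (9 * ε))) ?_ ?_
    · rw [← ENNReal.ofReal_ofNat 8, ← ENNReal.ofReal_mul (by norm_num), ENNReal.ofReal_le_one]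
      nlinarith
    · filter_upwards [hg1, ae_logMeasure_pos] with s hs hs0
      refine hs.trans (add_le_add le_rfl ?_)
      rw [← mul_assoc, ENNReal.ofReal_mul (by positivity), ENNReal.ofReal_natCast]
      gcongr
      exact ENNReal.ofReal_le_ofReal (hb9 s hs0)
  have hc0 := hz.enorm_apply_one_le hm hM ho
  rw [← hI] at hc0
  have hΛG : ∫⁻ s, ENNReal.ofReal (tailWeight m s) * G s ∂logMeasure ≤ Λ * B := by
    refine le_trans (le_of_eq ?_) (lintegral_mul_le_lnorm hpq
      (f := fun s => ENNReal.ofReal (s ^ (-κ)) * G s) (by fun_prop) ?_ ?_)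
    · refine lintegral_congr_ae ?_
      filter_upwards [ae_logMeasure_pos] with s hs
      have ht := tailWeight_pos m hs
      rw [← mul_assoc, ← ENNReal.ofReal_mul (by positivity), mul_assoc, ← Real.rpow_add hs]
      simp
    · have := measurable_tailWeight m
      fun_prop
    · filter_upwards [ae_logMeasure_pos] with s hs
      exact ENNReal.ofReal_le_one.2 (tailWeight_mul_rpow_le_one h0 hκ hs)
  have hb1 : ∀ᵐ s ∂logMeasure, b s ≤ 1 := by
    filter_upwards [ae_logMeasure_pos] with s hs
    exact ENNReal.ofReal_le_one.2 ((hb9 s hs).trans (by nlinarith))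
  have hbint : (∫⁻ s, b s ∂logMeasure) ^ (1 / q) ≤ ENNReal.ofReal (5 * η) := by
    have hle := lintegral_coefficient_le (m := m) (by omega) hεpos (by nlinarith) hx hM
    calc _ ≤ ENNReal.ofReal (25 * ε) ^ (1 / q) := ENNReal.rpow_le_rpow hle (by positivity)
      _ ≤ ENNReal.ofReal (25 * ε) ^ (1 / 2 : ℝ) :=
          ENNReal.rpow_le_rpow_of_exponent_ge (ENNReal.ofReal_le_one.2 (by nlinarith)) hq2
      _ = ENNReal.ofReal (5 * η) := by
          rw [ENNReal.ofReal_rpow_of_nonneg (by positivity) (by positivity), ← Real.sqrt_eq_rpow,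
            show 25 * ε = (5 * η) ^ 2 by rw [hε]; ring, Real.sqrt_sq (by positivity)]
  -- The tail weight is dominated by `s^{-κ}`, so the coefficient `b` can serve as the weight in
  -- Hölder's inequality.
  have hΛN : ∫⁻ s, ENNReal.ofReal (tailWeight m s) * (m * (b s * ‖z s‖ₑ)) ∂logMeasure
      ≤ m * (ENNReal.ofReal (5 * η) * X) := by
    calc _ ≤ ∫⁻ s, m * (b s * (ENNReal.ofReal (s ^ (-κ)) * ‖z s‖ₑ)) ∂logMeasure := by
          refine lintegral_mono_ae ?_
          filter_upwards [ae_logMeasure_pos] with s hs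
          have hle : ENNReal.ofReal (tailWeight m s) ≤ ENNReal.ofReal (s ^ (-κ)) := by
            refine ENNReal.ofReal_le_ofReal ?_
            rw [Real.rpow_neg hs.le, le_inv_comm₀ (tailWeight_pos m hs) (by positivity)]
            rw [le_inv_comm₀ (by positivity) (tailWeight_pos m hs),
              ← one_div, le_div_iff₀ (by positivity)]
            exact tailWeight_mul_rpow_le_one h0 hκ hs
          calc _ ≤ ENNReal.ofReal (s ^ (-κ)) * (m * (b s * ‖z s‖ₑ)) := by gcongr
            _ = _ := by ring
      _ = m * ∫⁻ s, b s * (ENNReal.ofReal (s ^ (-κ)) * ‖z s‖ₑ) ∂logMeasure :=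
          lintegral_const_mul' _ _ (ENNReal.natCast_ne_top m)
      _ ≤ _ := by
          gcongr
          refine (lintegral_mul_le_lnorm hpq (by fun_prop) hbm hb1).trans ?_
          gcongr
  have hc1 : ENNReal.ofReal I * ‖z 1‖ₑ ≤ 8 * (Λ * B + m * (ENNReal.ofReal (5 * η) * X)) := by
    refine hc0.trans ?_
    gcongr
    calc _ ≤ ∫⁻ s, (ENNReal.ofReal (tailWeight m s) * G s +
          ENNReal.ofReal (tailWeight m s) * (m * (b s * ‖z s‖ₑ))) ∂logMeasure := by
          refine lintegral_mono_ae ?_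
          filter_upwards [hg1] with s hs
          rw [← mul_add]
          gcongr
      _ ≤ _ := by
          have := measurable_tailWeight m
          rw [lintegral_add_left' (by fun_prop)]
          exact add_le_add hΛG hΛN
  -- Inserting the bound for `X` reproduces `z(1)` with a small factor; since `z(1)` is a finite
  -- number it is absorbed next, with no finiteness of `X` or `B` needed.
  have hc2 : 8 * (m * (ENNReal.ofReal (5 * η) * X)) ≤ ENNReal.ofReal I / 2 * (‖z 1‖ₑ + B) := by
    calc _ ≤ 8 * (m * (ENNReal.ofReal (5 * η) * (8 * (‖z 1‖ₑ + B)))) := by gcongr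
      _ = ENNReal.ofReal (320 * m * η) * (‖z 1‖ₑ + B) := by
          have e : ENNReal.ofReal (320 * m * η) = 8 * (m * (ENNReal.ofReal (5 * η) * 8)) := by
            rw [← ENNReal.ofReal_ofNat 8, ← ENNReal.ofReal_natCast m,
              ← ENNReal.ofReal_mul (by positivity), ← ENNReal.ofReal_mul (by positivity),
              ← ENNReal.ofReal_mul (by positivity)]
            congr 1
            ring
          rw [e]
          ring
      _ ≤ _ := by
          gcongr
          rw [← ENNReal.ofReal_ofNat 2, ← ENNReal.ofReal_div_of_pos two_pos]
          exact ENNReal.ofReal_le_ofReal (by linarith)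
  have hc3 : ENNReal.ofReal I * ‖z 1‖ₑ ≤ 2 * (8 * (Λ * B) + ENNReal.ofReal I / 2 * B) := by
    refine le_two_mul_of_le_add_half (by finiteness) (hc1.trans ?_)
    calc _ = 8 * (Λ * B) + 8 * (m * (ENNReal.ofReal (5 * η) * X)) := by ring
      _ ≤ 8 * (Λ * B) + ENNReal.ofReal I / 2 * (‖z 1‖ₑ + B) := by gcongr
      _ = _ := by
          simp only [div_eq_mul_inv]
          ring
  have hc4 : ‖z 1‖ₑ ≤ ENNReal.ofReal (16 * Λ.toReal / I + 1) * B := by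
    have hI0 : ENNReal.ofReal I ≠ 0 := by simpa using hIpos
    rw [← ENNReal.mul_le_mul_iff_right hI0 ENNReal.ofReal_ne_top]
    refine hc3.trans (le_of_eq ?_)
    have e : ENNReal.ofReal I * ENNReal.ofReal (16 * Λ.toReal / I + 1)
        = 2 * (8 * Λ + ENNReal.ofReal I / 2) := by
      rw [← ENNReal.ofReal_toReal hΛtop, ← ENNReal.ofReal_ofNat 2, ← ENNReal.ofReal_ofNat 8,
        ← ENNReal.ofReal_div_of_pos two_pos, ← ENNReal.ofReal_mul (by positivity),
        ← ENNReal.ofReal_mul (by positivity), ← ENNReal.ofReal_add (by positivity) (by positivity),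
        ← ENNReal.ofReal_mul (by positivity), ENNReal.toReal_ofReal (by positivity)]
      congr 1
      field_simp
      ring
    rw [← mul_assoc (ENNReal.ofReal I), e]
    ring
  calc X ≤ 8 * (‖z 1‖ₑ + B) := hXle
    _ ≤ 8 * (ENNReal.ofReal (16 * Λ.toReal / I + 1) * B + B) := by gcongr
    _ = _ := by
        have e : ENNReal.ofReal (8 * (16 * Λ.toReal / I + 2))
            = 8 * (ENNReal.ofReal (16 * Λ.toReal / I + 1) + 1) := by
          rw [← ENNReal.ofReal_one, ← ENNReal.ofReal_ofNat 8,
            ← ENNReal.ofReal_add (by positivity) (by positivity),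
            ← ENNReal.ofReal_mul (by positivity)]
          congr 1
          ring
        rw [e]
        ring

/-! ### Geometry: the perturbation equation and `|W| = |q|`. -/

theorem one_add_normalPart_sq {w : ℂ} (hw : ‖w‖ ≤ 1) :
    (1 + normalPart w) ^ 2 + w.re ^ 2 + w.im ^ 2 = 1 := by
  have h1 : ‖w‖ ^ 2 ≤ 1 := pow_le_one₀ (norm_nonneg _) hw
  have h2 : ‖w‖ ^ 2 = w.re ^ 2 + w.im ^ 2 := by
    rw [← Complex.normSq_eq_norm_sq, Complex.normSq_apply]; ring
  rw [normalPart, add_sub_cancel, Real.sq_sqrt (by linarith)]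
  linarith

theorem differentiableAt_normalPart {z : ℝ → ℂ} {t : ℝ} (hz : DifferentiableAt ℝ z t)
    (h1 : ‖z t‖ < 1) : DifferentiableAt ℝ (fun t => normalPart (z t)) t := by
  have h : 1 - ‖z t‖ ^ 2 ≠ 0 := by
    have : ‖z t‖ ^ 2 < 1 := pow_lt_one₀ (norm_nonneg _) h1 two_ne_zero
    linarith
  unfold normalPart
  exact (((hz.norm_sq ℝ).const_sub 1).sqrt h).sub_const 1

/-- The horizontal component, before rotation, of the profile that is described by `z`. -/
noncomputable def horizComp (m : ℕ) (z : ℝ → ℂ) (t : ℝ) : ℝ :=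
  (1 + normalPart (z t)) * h₁ m t - (z t).im * h₃ m t

/-- The vertical component of the profile that is described by `z`. -/
noncomputable def vertComp (m : ℕ) (z : ℝ → ℂ) (t : ℝ) : ℝ :=
  (1 + normalPart (z t)) * h₃ m t + (z t).im * h₁ m t

theorem IsSplitting.eq_components {m : ℕ} {v : ℝ → Fin 3 → ℝ} {s α : ℝ} {z : ℝ → ℂ}
    (h : IsSplitting m v s α z) {r : ℝ} (hr : 0 < r) :
    v r = ![Real.cos α * horizComp m z (r / s) - Real.sin α * (z (r / s)).re,
      Real.sin α * horizComp m z (r / s) + Real.cos α * (z (r / s)).re,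
      vertComp m z (r / s)] := by
  rw [h r hr]
  ext i
  fin_cases i <;>
    simp [rot, Vrho, hvec, jhat, horizComp, vertComp, Matrix.mulVec, dotProduct,
      Fin.sum_univ_three, cross_apply] <;>
    first | ring1 | exact Or.inl (by ring1)

theorem fullOp_re (m : ℕ) (z : ℝ → ℂ) (t : ℝ) :
    (fullOp m z t).re = (deriv z t).re + m / t * vertComp m z t * (z t).re := by
  simp only [fullOp, linOp, nonlin, vertComp, Complex.add_re, Complex.re_ofReal_mul, Complex.I_re,
    mul_zero, add_zero]
  ring

theorem fullOp_im (m : ℕ) (z : ℝ → ℂ) (t : ℝ) :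
    (fullOp m z t).im = (deriv z t).im +
      m / t * (vertComp m z t * (z t).im + normalPart (z t) * h₁ m t) := by
  simp only [fullOp, linOp, nonlin, vertComp, Complex.add_im, Complex.im_ofReal_mul, Complex.I_im,
    mul_one]
  ring

theorem HasDerivAt.comp_div_const {f : ℝ → ℝ} {f' s t : ℝ} (hf : HasDerivAt f f' t) (hs : 0 < s) :
    HasDerivAt (fun r => f (r / s)) (f' * (1 / s)) (s * t) := by
  have hts : s * t / s = t := by field_simp
  rw [← hts] at hf
  exact HasDerivAt.comp (s * t) hf ((hasDerivAt_id (s * t)).div_const s)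

theorem IsSplitting.hasDerivAt {m : ℕ} {v : ℝ → Fin 3 → ℝ} {s α : ℝ} {z : ℝ → ℂ}
    (h : IsSplitting m v s α z) (hs : 0 < s) {t A' B' C' : ℝ} (ht : 0 < t)
    (hA : HasDerivAt (horizComp m z) A' t) (hB : HasDerivAt (fun r => (z r).re) B' t)
    (hC : HasDerivAt (vertComp m z) C' t) :
    HasDerivAt v ![Real.cos α * (A' * (1 / s)) - Real.sin α * (B' * (1 / s)),
      Real.sin α * (A' * (1 / s)) + Real.cos α * (B' * (1 / s)), C' * (1 / s)] (s * t) := by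
  have hst : 0 < s * t := by positivity
  have hA2 := HasDerivAt.comp_div_const hA hs
  have hB2 := HasDerivAt.comp_div_const hB hs
  have hC2 := HasDerivAt.comp_div_const hC hs
  have hev : v =ᶠ[𝓝 (s * t)] fun r =>
      ![Real.cos α * horizComp m z (r / s) - Real.sin α * (z (r / s)).re,
        Real.sin α * horizComp m z (r / s) + Real.cos α * (z (r / s)).re,
        vertComp m z (r / s)] := by
    filter_upwards [Ioi_mem_nhds hst] with r hr using h.eq_components hr
  refine HasDerivAt.congr_of_eventuallyEq ?_ hev
  rw [hasDerivAt_pi]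
  intro i
  fin_cases i
  · exact (hA2.const_mul _).fun_sub (hB2.const_mul _)
  · exact (hA2.const_mul _).fun_add (hB2.const_mul _)
  · exact hC2

/-- The length of `W` in terms of the components of the profile. -/
theorem IsSplitting.dotProduct_W {m : ℕ} {v : ℝ → Fin 3 → ℝ} {s α : ℝ} {z : ℝ → ℂ}
    (h : IsSplitting m v s α z) (hs : 0 < s) {t A' B' C' : ℝ} (ht : 0 < t)
    (hA : HasDerivAt (horizComp m z) A' t) (hB : HasDerivAt (fun r => (z r).re) B' t)
    (hC : HasDerivAt (vertComp m z) C' t) :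
    s ^ 2 * (W m v (s * t) ⬝ᵥ W m v (s * t)) =
      (A' + m / t * vertComp m z t * horizComp m z t) ^ 2 +
        (B' + m / t * vertComp m z t * (z t).re) ^ 2 +
        (C' - m / t * (horizComp m z t ^ 2 + (z t).re ^ 2)) ^ 2 := by
  have hv := h.hasDerivAt hs ht hA hB hC
  have hvt := h.eq_components (r := s * t) (by positivity)
  rw [show s * t / s = t by field_simp] at hvt
  have hmst : (m : ℝ) / (s * t) = m / t * (1 / s) := by field_simp
  have hcs := Real.cos_sq_add_sin_sq α
  rw [W, hv.deriv, hvt, hmst]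
  generalize horizComp m z t = A
  generalize vertComp m z t = C
  generalize (z t).re = x
  generalize (m : ℝ) / t = k
  simp only [rotGen, dotProduct, Fin.sum_univ_three, cross_apply, Matrix.mulVec, Pi.sub_apply,
    Pi.smul_apply, smul_eq_mul, Matrix.of_apply, Matrix.cons_val_zero, Matrix.cons_val_one,
    Matrix.cons_val]
  have hs2 : s ^ 2 * (1 / s) ^ 2 = 1 := by field_simp
  generalize 1 / s = σ at hs2 ⊢
  generalize Real.cos α = c at hcs ⊢
  generalize Real.sin α = d at hcs ⊢
  -- Rotation invariance: `v × Rv = k - v₃ v` commutes with rotations about the vertical axis. The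
  -- factors equal to `1` are kept so that the rest is a polynomial identity.
  have e : s ^ 2 * σ ^ 2 * ((c ^ 2 + d ^ 2) * ((A' + k * C * A) ^ 2 + (B' + k * C * x) ^ 2) +
      (C' - k * ((c ^ 2 + d ^ 2) * (A ^ 2 + x ^ 2))) ^ 2) =
      (A' + k * C * A) ^ 2 + (B' + k * C * x) ^ 2 + (C' - k * (A ^ 2 + x ^ 2)) ^ 2 := by
    rw [hs2, hcs]; ring
  rw [← e]
  ring

/-- The perturbation equation: the operator `fullOp` is the tangential part of `W`. -/
theorem IsSplitting.norm_fullOp_sq_le {m : ℕ} {v : ℝ → Fin 3 → ℝ} {s α : ℝ} {z : ℝ → ℂ}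
    (h : IsSplitting m v s α z) (hs : 0 < s) {t : ℝ} (ht : 0 < t) (hz : DifferentiableAt ℝ z t)
    (hz1 : ‖z t‖ < 1) : ‖fullOp m z t‖ ^ 2 ≤ s ^ 2 * (W m v (s * t) ⬝ᵥ W m v (s * t)) := by
  obtain ⟨g, hg⟩ : ∃ g, HasDerivAt (fun t => normalPart (z t)) g t :=
    ⟨_, (differentiableAt_normalPart hz hz1).hasDerivAt⟩
  have hre : HasDerivAt (fun r => (z r).re) (deriv z t).re t :=
    Complex.reCLM.hasFDerivAt.comp_hasDerivAt t hz.hasDerivAt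
  have him : HasDerivAt (fun r => (z r).im) (deriv z t).im t :=
    Complex.imCLM.hasFDerivAt.comp_hasDerivAt t hz.hasDerivAt
  have hd1 := hasDerivAt_h₁ m ht
  have hd3 := hasDerivAt_h₃ m ht
  have hA : HasDerivAt (horizComp m z) _ t :=
    ((hg.const_add 1).fun_mul hd1).fun_sub (him.fun_mul hd3)
  have hC : HasDerivAt (vertComp m z) _ t :=
    ((hg.const_add 1).fun_mul hd3).fun_add (him.fun_mul hd1)
  have hunit := one_add_normalPart_sq hz1.le
  have hh := h₁_sq_add_h₃_sq m ht
  have hn : ‖fullOp m z t‖ ^ 2 = (fullOp m z t).re ^ 2 + (fullOp m z t).im ^ 2 := by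
    rw [← Complex.normSq_eq_norm_sq, Complex.normSq_apply]; ring
  rw [hn, h.dotProduct_W hs ht hA hre hC, fullOp_re, fullOp_im, horizComp, vertComp]
  generalize (z t).re = x at hunit ⊢
  generalize (z t).im = y at hunit ⊢
  generalize (deriv z t).re = x'
  generalize (deriv z t).im = y'
  generalize (m : ℝ) / t = k
  generalize normalPart (z t) = γ at hunit ⊢
  generalize h₁ m t = a at hh ⊢
  generalize h₃ m t = b at hh ⊢
  set C := (1 + γ) * b + y * a with hCdef
  set A := (1 + γ) * a - y * b with hAdef
  set A' := g * a + (1 + γ) * -(k * a * b) - (y' * b + y * (k * a ^ 2)) with hA'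
  set C' := g * b + (1 + γ) * (k * a ^ 2) + (y' * a + y * -(k * a * b)) with hC'
  -- The profile has unit length.
  have hAC : A ^ 2 + x ^ 2 = 1 - C ^ 2 := by
    rw [hAdef, hCdef]
    linear_combination ((1 + γ) ^ 2 + y ^ 2) * hh + hunit
  have hy1 : a * C - b * A = y := by
    rw [hAdef, hCdef]
    linear_combination y * hh
  -- The imaginary part is the component of the unrotated `W` along `h × j = (-h₃, 0, h₁)`; the real
  -- part is the one along `j`.
  have him' : y' + k * (C * y + γ * a) =
      -b * (A' + k * C * A) + a * (C' - k * (A ^ 2 + x ^ 2)) := by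
    rw [hAC, hA', hC']
    linear_combination (-y' - k * a * (1 + γ)) * hh - k * C * hy1
  rw [him']
  -- Pythagoras in the orthonormal basis `h × j`, `h` of the plane orthogonal to `j`. The component
  -- along `h` is dropped, hence only an inequality.
  have e : (A' + k * C * A) ^ 2 + (C' - k * (A ^ 2 + x ^ 2)) ^ 2 =
      (-b * (A' + k * C * A) + a * (C' - k * (A ^ 2 + x ^ 2))) ^ 2 +
      (a * (A' + k * C * A) + b * (C' - k * (A ^ 2 + x ^ 2))) ^ 2 := by
    linear_combination (-(A' + k * C * A) ^ 2 - (C' - k * (A ^ 2 + x ^ 2)) ^ 2) * hh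
  linarith [sq_nonneg (a * (A' + k * C * A) + b * (C' - k * (A ^ 2 + x ^ 2)))]

/-- In an orthonormal tangent frame, `|W| = |q|`. -/
theorem dotProduct_frame {v e w : Fin 3 → ℝ} {q : ℂ} (hv : v ⬝ᵥ v = 1) (he : e ⬝ᵥ e = 1)
    (hev : e ⬝ᵥ v = 0) (hw : w = q.re • e + q.im • (v ⨯₃ e)) : w ⬝ᵥ w = ‖q‖ ^ 2 := by
  have h1 : e ⬝ᵥ (v ⨯₃ e) = 0 := dot_cross_self v e
  have h2 : (v ⨯₃ e) ⬝ᵥ (v ⨯₃ e) = 1 := by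
    rw [cross_dot_cross, hv, he, dotProduct_comm v e, hev]; ring
  have h3 : (v ⨯₃ e) ⬝ᵥ e = 0 := by rw [dotProduct_comm, h1]
  rw [hw]
  simp only [add_dotProduct, dotProduct_add, smul_dotProduct, dotProduct_smul, he, h1, h2, h3,
    smul_eq_mul]
  rw [← Complex.normSq_eq_norm_sq, Complex.normSq_apply]
  ring

theorem IsSplitMap.ae_norm_fullOp_le {m : ℕ} {v : ℝ → Fin 3 → ℝ} {s α : ℝ} {z q : ℝ → ℂ}
    (h : IsSplitMap m v s α z q) (hz1 : ∀ t, 0 < t → ‖z t‖ < 1) :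
    ∀ᵐ t ∂logMeasure, ‖fullOp m z t‖ ≤ s * ‖q (s * t)‖ := by
  obtain ⟨e, he, hq⟩ := h.hasimoto
  have hs := h.scale_pos
  rw [ae_radialMeasure_iff] at hq
  rw [ae_logMeasure_iff]
  filter_upwards [ae_volume_comp_mul hs hq, h.memX.locallyAC.ae_differentiableAt] with t hqt hd ht
  have hst : 0 < s * t := by positivity
  have h1 := h.splitting.norm_fullOp_sq_le hs ht (hd ht) (hz1 t ht)
  rw [dotProduct_frame (h.profile.unit _ hst) (he.unit _ hst) (he.tangent _ hst) (hqt hst),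
    ← mul_pow] at h1
  exact (pow_le_pow_iff_left₀ (norm_nonneg _) (by positivity) two_ne_zero).1 h1

/-! ### Return to the radial norms and conclusion. -/

theorem radialNorm_eq_lnorm {p : ℝ} (hp : 0 < p) (f : ℝ → ℂ) :
    radialNorm p f = lnorm p logMeasure (fun r => ENNReal.ofReal (r ^ (2 / p)) * ‖f r‖ₑ) := by
  rw [radialNorm, eLpNorm_eq_lintegral_rpow_enorm_toReal (by simpa using hp)
    ENNReal.ofReal_ne_top, ENNReal.toReal_ofReal hp.le, lintegral_radialMeasure_eq_logMeasure, lnorm]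
  congr 1
  refine lintegral_congr_ae ?_
  filter_upwards [ae_logMeasure_pos] with r hr
  rw [ENNReal.mul_rpow_of_nonneg _ _ hp.le, ENNReal.ofReal_rpow_of_nonneg (by positivity) hp.le,
    ← Real.rpow_mul hr.le, div_mul_cancel₀ _ hp.ne', Real.rpow_two]

theorem lnorm_congr {p : ℝ} {μ : Measure ℝ} {f g : ℝ → ℝ≥0∞} (h : ∀ᵐ r ∂μ, f r = g r) :
    lnorm p μ f = lnorm p μ g := by
  unfold lnorm
  congr 1
  refine lintegral_congr_ae ?_
  filter_upwards [h] with r hr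
  rw [hr]

/-- The `L^p` norm of a power times a function as a weighted norm for `dr / r`. -/
theorem radialNorm_eq_weighted {p κ : ℝ} (hp : 0 < p) {f g : ℝ → ℂ}
    (h : ∀ r, 0 < r → ‖f r‖ = r ^ (-κ - 2 / p) * ‖g r‖) :
    radialNorm p f = lnorm p logMeasure (fun r => ENNReal.ofReal (r ^ (-κ)) * ‖g r‖ₑ) := by
  rw [radialNorm_eq_lnorm hp]
  refine lnorm_congr ?_
  filter_upwards [ae_logMeasure_pos] with r hr
  rw [← ofReal_norm, ← ofReal_norm, h r hr, ← ENNReal.ofReal_mul (by positivity),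
    ← ENNReal.ofReal_mul (by positivity), ← mul_assoc, ← Real.rpow_add hr]
  congr 3
  ring

/-- The equation is solved for `z'`; since `|h₃| ≤ 1` and the nonlinear coefficient is at most `3`,
the remaining terms cost `1 + 3 = 4`. -/
theorem enorm_mul_deriv_le (m : ℕ) {z : ℝ → ℂ} {r : ℝ} (hr : 0 < r) (hz : ‖z r‖ ≤ 1) :
    ‖(r : ℂ) * deriv z r‖ₑ ≤ ‖(r : ℂ) * fullOp m z r‖ₑ + 4 * m * ‖z r‖ₑ := by
  have h1 := h₁_pos m hr
  have hr' : (r : ℂ) ≠ 0 := by exact_mod_cast hr.ne'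
  have e : (r : ℂ) * deriv z r = (r : ℂ) * fullOp m z r - m * (h₃ m r * z r + nonlin m z r) := by
    rw [fullOp, linOp]; push_cast; field_simp; ring
  rw [e]
  refine (enorm_sub_le).trans (add_le_add le_rfl ?_)
  have hN : ‖(h₃ m r : ℂ) * z r + nonlin m z r‖ ≤ 4 * ‖z r‖ := by
    refine (norm_add_le _ _).trans ?_
    have h3 : ‖(h₃ m r : ℂ) * z r‖ ≤ ‖z r‖ := by
      rw [norm_mul, Complex.norm_real]
      exact mul_le_of_le_one_left (norm_nonneg _) (abs_h₃_le_one m hr)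
    have h4 : ‖z r‖ ^ 2 + 2 * h₁ m r * ‖z r‖ ≤ 3 := by
      have := h₁_le_one m hr
      nlinarith [norm_nonneg (z r), mul_nonneg h1.le (sub_nonneg.2 hz)]
    have h5 := norm_nonlin_le m hr hz
    nlinarith [norm_nonneg (z r)]
  rw [← ofReal_norm, ← ofReal_norm, norm_mul, Complex.norm_natCast,
    ENNReal.ofReal_mul (by positivity), ENNReal.ofReal_natCast]
  calc _ ≤ (m : ℝ≥0∞) * ENNReal.ofReal (4 * ‖z r‖) := by gcongr
    _ = _ := by
        rw [ENNReal.ofReal_mul (by norm_num), ENNReal.ofReal_ofNat]; ring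

theorem lnorm_logMeasure_comp_mul {p s : ℝ} (hs : 0 < s) (f : ℝ → ℝ≥0∞) :
    lnorm p logMeasure (fun r => f (s * r)) = lnorm p logMeasure f := by
  unfold lnorm
  rw [lintegral_logMeasure_comp_mul (fun r => f r ^ p) hs]

/-- Substitute `r = s t`, under which `dr/r` is invariant; the weight alone changes, by `s^κ`. -/
theorem IsSplitMap.lnorm_fullOp_le {m : ℕ} {v : ℝ → Fin 3 → ℝ} {s α : ℝ} {z q : ℝ → ℂ}
    (h : IsSplitMap m v s α z q) (hz1 : ∀ t, 0 < t → ‖z t‖ < 1) {p : ℝ} (hp : 0 < p) (κ : ℝ) :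
    lnorm p logMeasure (fun r => ENNReal.ofReal (r ^ (-κ)) * ‖(r : ℂ) * fullOp m z r‖ₑ) ≤
      ENNReal.ofReal (s ^ κ) *
        lnorm p logMeasure (fun r => ENNReal.ofReal (r ^ (-κ)) * ‖(r : ℂ) * q r‖ₑ) := by
  have hs := h.scale_pos
  rw [← lnorm_const_mul hp ENNReal.ofReal_ne_top, ← lnorm_logMeasure_comp_mul hs
    (fun r => ENNReal.ofReal (s ^ κ) * (ENNReal.ofReal (r ^ (-κ)) * ‖(r : ℂ) * q r‖ₑ))]
  refine lnorm_mono hp.le ?_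
  filter_upwards [h.ae_norm_fullOp_le hz1, ae_logMeasure_pos] with t ht h0
  rw [← ofReal_norm, ← ofReal_norm, ← ENNReal.ofReal_mul (by positivity),
    ← ENNReal.ofReal_mul (by positivity), ← ENNReal.ofReal_mul (by positivity)]
  refine ENNReal.ofReal_le_ofReal ?_
  have e : s ^ κ * (s * t) ^ (-κ) = t ^ (-κ) := by
    rw [Real.mul_rpow hs.le h0.le, ← mul_assoc, ← Real.rpow_add hs]
    simp
  rw [← mul_assoc, e, norm_mul, norm_mul, Complex.norm_real, Complex.norm_real,
    Real.norm_of_nonneg h0.le, Real.norm_of_nonneg (by positivity)]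
  refine mul_le_mul_of_nonneg_left ?_ (by positivity)
  calc t * ‖fullOp m z t‖ ≤ t * (s * ‖q (s * t)‖) := by gcongr
    _ = _ := by ring

/-- The weighted form of the two estimates. -/
theorem exists_lnorm_add_le {m : ℕ} (hm : 3 ≤ m) : ∃ ε : ℝ, 0 < ε ∧
    ∀ κ p : ℝ, 0 ≤ κ → κ ≤ 1 → κ < m - 2 → 2 ≤ p → ∃ C : ℝ, 0 < C ∧
      ∀ (v : ℝ → Fin 3 → ℝ) (s α : ℝ) (z q : ℝ → ℂ),
        IsSplitMap m v s α z q → xNorm z ≤ ENNReal.ofReal ε →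
          lnorm p logMeasure (fun r => ENNReal.ofReal (r ^ (-κ)) * ‖(r : ℂ) * deriv z r‖ₑ) +
              lnorm p logMeasure (fun r => ENNReal.ofReal (r ^ (-κ)) * ‖z r‖ₑ) ≤
            ENNReal.ofReal (C * s ^ κ) *
              lnorm p logMeasure (fun r => ENNReal.ofReal (r ^ (-κ)) * ‖(r : ℂ) * q r‖ₑ) := by
  obtain ⟨ε, hε, hε1, H⟩ := exists_lnorm_le_fullOp hm
  refine ⟨ε, hε, fun κ p h0 h1 hκ hp => ?_⟩
  obtain ⟨C, hC, H⟩ := H κ p h0 h1 hκ hp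
  refine ⟨1 + (4 * m + 1) * C, by positivity, fun v s α z q h hx => ?_⟩
  have hz := h.memX.locallyAC
  have hz1 : ∀ r, 0 < r → ‖z r‖ < 1 := fun r hr =>
    (hz.norm_le_of_xNorm_le hε hx hr).trans_lt hε1
  have hX := H z hz h.orthogonal hx
  have hB := h.lnorm_fullOp_le hz1 (p := p) (by linarith) κ
  have hzm := hz.aemeasurable
  have hGm : AEMeasurable (fun r : ℝ => ‖(r : ℂ) * fullOp m z r‖ₑ) logMeasure :=
    (Complex.measurable_ofReal.aemeasurable.mul (hz.aemeasurable_fullOp m)).enorm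
  set X := lnorm p logMeasure (fun r => ENNReal.ofReal (r ^ (-κ)) * ‖z r‖ₑ) with hXdef
  set B := lnorm p logMeasure (fun r => ENNReal.ofReal (r ^ (-κ)) * ‖(r : ℂ) * fullOp m z r‖ₑ)
    with hBdef
  have hd : lnorm p logMeasure (fun r => ENNReal.ofReal (r ^ (-κ)) * ‖(r : ℂ) * deriv z r‖ₑ) ≤
      B + 4 * m * X := by
    calc _ ≤ lnorm p logMeasure (fun r => ENNReal.ofReal (r ^ (-κ)) * ‖(r : ℂ) * fullOp m z r‖ₑ +
          4 * m * (ENNReal.ofReal (r ^ (-κ)) * ‖z r‖ₑ)) := by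
          refine lnorm_mono (by linarith) ?_
          filter_upwards [ae_logMeasure_pos] with r hr
          calc _ ≤ ENNReal.ofReal (r ^ (-κ)) * (‖(r : ℂ) * fullOp m z r‖ₑ + 4 * m * ‖z r‖ₑ) := by
                gcongr; exact enorm_mul_deriv_le m hr (hz1 r hr).le
            _ = _ := by ring
      _ ≤ _ := lnorm_add_le (by linarith) (by fun_prop) (by fun_prop)
      _ = _ := by rw [lnorm_const_mul (by linarith) (by finiteness)]
  have hs := h.scale_pos
  have e : ENNReal.ofReal (1 + (4 * m + 1) * C) = 1 + (4 * m + 1) * ENNReal.ofReal C := by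
    rw [ENNReal.ofReal_add zero_le_one (by positivity), ENNReal.ofReal_one,
      ENNReal.ofReal_mul (by positivity), ENNReal.ofReal_add (by positivity) zero_le_one,
      ENNReal.ofReal_one, ENNReal.ofReal_mul (by norm_num), ENNReal.ofReal_natCast,
      ENNReal.ofReal_ofNat]
  calc _ ≤ B + 4 * m * X + X := by gcongr
    _ = B + (4 * m + 1) * X := by ring
    _ ≤ B + (4 * m + 1) * (ENNReal.ofReal C * B) := by gcongr
    _ = ENNReal.ofReal (1 + (4 * m + 1) * C) * B := by rw [e]; ring
    _ ≤ _ := by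
        rw [ENNReal.ofReal_mul (by positivity), mul_assoc]
        gcongr

end SchrodingerMap

theorem proposition2p2 (m : ℕ) (hm : 3 ≤ m) :
    ∃ ε : ℝ, 0 < ε ∧
      (∀ p : ℝ, 2 ≤ p → ∃ C : ℝ, 0 < C ∧
        ∀ (v : ℝ → Fin 3 → ℝ) (s α : ℝ) (z q : ℝ → ℂ),
          IsSplitMap m v s α z q → xNorm z ≤ ENNReal.ofReal ε →
            radialNorm p (deriv z) + radialNorm p (fun ρ => z ρ / ρ)
              ≤ ENNReal.ofReal (C * s ^ (1 - 2 / p)) * radialNorm p q) ∧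
      (3 < m → ∃ C : ℝ, 0 < C ∧
        ∀ (v : ℝ → Fin 3 → ℝ) (s α : ℝ) (z q : ℝ → ℂ),
          IsSplitMap m v s α z q → xNorm z ≤ ENNReal.ofReal ε →
            radialNorm 2 (fun ρ => deriv z ρ / ρ) + radialNorm 2 (fun ρ => z ρ / (ρ : ℂ) ^ 2)
              ≤ ENNReal.ofReal (C * s) * radialNorm 2 (fun r => q r / r)) := by
  obtain ⟨ε, hε, H⟩ := exists_lnorm_add_le hm
  have hm3 : (3 : ℝ) ≤ m := by exact_mod_cast hm
  refine ⟨ε, hε, fun p hp => ?_, fun hm4 => ?_⟩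
  · have hp0 : 0 < p := by linarith
    have h2p : 0 < 2 / p := by positivity
    have h2p1 : 2 / p ≤ 1 := (div_le_one hp0).2 hp
    -- Here `κ < 1 ≤ m - 2`, so `m = 3` is allowed for every finite `p`.
    obtain ⟨C, hC, H⟩ := H (1 - 2 / p) p (by linarith) (by linarith) (by linarith) hp
    refine ⟨C, hC, fun v s α z q h hx => ?_⟩
    have key : ∀ r : ℝ, 0 < r → r ^ (-(1 - 2 / p) - 2 / p) = r⁻¹ := by
      intro r hr
      rw [show -(1 - 2 / p) - 2 / p = -1 by ring, Real.rpow_neg_one]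
    have w : ∀ f : ℝ → ℂ, radialNorm p f = lnorm p logMeasure
        (fun r => ENNReal.ofReal (r ^ (-(1 - 2 / p))) * ‖(r : ℂ) * f r‖ₑ) := fun f =>
      radialNorm_eq_weighted (g := fun r => (r : ℂ) * f r) hp0 fun r hr => by
        rw [key r hr, norm_mul, Complex.norm_real, Real.norm_of_nonneg hr.le,
          inv_mul_cancel_left₀ hr.ne']
    have wz : radialNorm p (fun ρ => z ρ / ρ) = lnorm p logMeasure
        (fun r => ENNReal.ofReal (r ^ (-(1 - 2 / p))) * ‖z r‖ₑ) :=
      radialNorm_eq_weighted hp0 fun r hr => by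
        rw [key r hr, norm_div, Complex.norm_real, Real.norm_of_nonneg hr.le, div_eq_inv_mul]
    rw [w (deriv z), w q, wz]
    exact H v s α z q h hx
  · have hm4' : (4 : ℝ) ≤ m := by exact_mod_cast hm4
    -- The choice `κ = 1` needs `1 < m - 2`, which is exactly `m > 3`.
    obtain ⟨C, hC, H⟩ := H 1 2 zero_le_one le_rfl (by linarith) le_rfl
    refine ⟨C, hC, fun v s α z q h hx => ?_⟩
    have key : ∀ r : ℝ, 0 < r → r ^ (-(1 : ℝ) - 2 / 2) = (r ^ 2)⁻¹ := by
      intro r hr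
      rw [show -(1 : ℝ) - 2 / 2 = -2 by norm_num, Real.rpow_neg hr.le, Real.rpow_two]
    have w : ∀ f : ℝ → ℂ, radialNorm 2 (fun r => f r / r) = lnorm 2 logMeasure
        (fun r => ENNReal.ofReal (r ^ (-(1 : ℝ))) * ‖(r : ℂ) * f r‖ₑ) := fun f =>
      radialNorm_eq_weighted (g := fun r => (r : ℂ) * f r) two_pos fun r hr => by
        rw [key r hr, norm_mul, norm_div, Complex.norm_real, Real.norm_of_nonneg hr.le]
        field_simp
    have wz : radialNorm 2 (fun ρ => z ρ / (ρ : ℂ) ^ 2) = lnorm 2 logMeasure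
        (fun r => ENNReal.ofReal (r ^ (-(1 : ℝ))) * ‖z r‖ₑ) :=
      radialNorm_eq_weighted two_pos fun r hr => by
        rw [key r hr, norm_div, norm_pow, Complex.norm_real, Real.norm_of_nonneg hr.le,
          div_eq_inv_mul]
    rw [w (deriv z), w q, wz]
    have := H v s α z q h hx
    rwa [Real.rpow_one] at this
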